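/- **Setting.** Let $\mathfrak g$ be a finite-dimensional semisimple complex Lie algebra, $\kappa$ the opposite of its Killing form, $C_{12}$ the corresponding split Casimir. Let $\Sigma$ be a finite set of sites with multiplicities $m_\alpha\ge 1$, pairwise distinct positions $z_\alpha\in\mathbb C$ and levels $\ell^\alpha_p\in\mathbb C$ ($0\le p<m_\alpha$) with $\ell^\alpha_{m_\alpha-1}\neq 0$ and $\sum_\alpha \ell^\alpha_0=0$. For $\mathfrak g$-valued Takiff currents $J^\alpha_p(x)$, with Poisson bracket $\{J^\alpha_{p\,\mathbf 1}(x),J^\beta_{q\,\mathbf 2}(y)\}=\delta_{\alpha\beta}\bigl([C_{12},J^\alpha_{p+q\,\mathbf 1}(x)]\delta_{xy}-\ell^\alpha_{p+q}C_{12}\,\partial_x\delta_{xy}\bigr)$ if $p+q<m_\alpha$ and $0$ otherwise, put $$\varphi(z)=\sum_{\alpha,p}\frac{\ell^\alpha_p}{(z-z_\alpha)^{p+1}},\qquad \Gamma(z)=\sum_{\alpha,p}\frac{J^\alpha_p}{(z-z_\alpha)^{p+1}},\qquad \mathcal C=\sum_\alpha J^\alpha_0,\qquad \chi(u)=-u^{-2}\varphi(1/u)$$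 ($\chi$ extended to the removable singularity $u=0$), and let $\mathcal B,\mathcal B_1$ be the coefficients in $\Gamma(1/u)=u\,\mathcal C-u^2\mathcal B-u^3\mathcal B_1+O(u^4)$. The sign $\approx$ denotes equality on the constraint surface $\mathcal C=0$. Suppose that the finite zeroes of $\varphi$ are simple, and that one of the following holds. (i) $\chi(0)\ne0$; then $\zeta_1,\dots,\zeta_M\in\mathbb C$ denote the zeroes of $\varphi$. (ii) $\chi(0)=0$ and $\chi'(0)\neq0$; then $\zeta_1,\dots,\zeta_{M-1}\in\mathbb C$ denote the finite zeroes of $\varphi$, and $\zeta_M=\infty$. Let $\epsilon_1,\dots,\epsilon_M\in\{1,-1\}$, $I_\pm=\{i\le M:\epsilon_i=\pm1\}$, and, in case (ii), $I_{f,\pm}=I_\pm\cap\{1,\dots,M-1\}$, $\delta^\pm_M=1$ if $M\in I_\pm$ and $\delta_M^\pm=0$ otherwise. Let $\mathcal H=\sum_{i=1}^M\epsilon_i\mathcal Q_i+\int dx\,\kappa(\mu,\mathcal C)$, where $\mu$ is a $\mathfrak g$-valued Lagrange multiplier and $\mathcal Q_i$ is the residue at $\zeta_i$ of $-\frac{1}{2\varphi(z)}\int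 dx\,\kappa(\Gamma(z),\Gamma(z))\,dz$. Let $\mathcal L(z)=\Gamma(z)/\varphi(z)$ and $$\mathcal M(z)=\sum_{i=1}^M\frac{\epsilon_i}{\varphi'(\zeta_i)}\frac{\Gamma(\zeta_i)}{z-\zeta_i}+\mu\quad\text{in case (i)},$$ $$\mathcal M(z)=\sum_{i=1}^{M-1}\frac{\epsilon_i}{\varphi'(\zeta_i)}\frac{\Gamma(\zeta_i)}{z-\zeta_i}+\epsilon_M\Bigl(\mathcal L(z)-\sum_{i=1}^{M-1}\frac{1}{\varphi'(\zeta_i)}\frac{\Gamma(\zeta_i)}{z-\zeta_i}\Bigr)+\mu\quad\text{in case (ii)}.$$ **Claim.** $(\mathcal M,\mathcal L)$ is a Lax pair: for all smooth solutions of $\partial_tJ=\{\mathcal H,J\}$ with $\mathcal C=0$ and smooth $\mu$, $\partial_t\mathcal L(z)-\partial_x\mathcal M(z)+[\mathcal M(z),\mathcal L(z)]=0$. Its light-cone components $\mathcal L_\pm(z)=\mathcal M(z)\pm\mathcal L(z)$ are given as follows, for all $z$ different from the $z_\alpha$ and from the finite $\zeta_i$. In case (i), $$\mathcal L_\pm(z)\approx\pm2\sum_{i\in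 I_\pm}\frac1{\varphi'(\zeta_i)}\frac{\Gamma(\zeta_i)}{z-\zeta_i}+\mu\pm\frac{\mathcal B}{\chi(0)}.$$ In case (ii), $$\mathcal L_\pm(z)\approx\pm2\Bigl(\sum_{i\in I_{f,\pm}}\frac1{\varphi'(\zeta_i)}\frac{\Gamma(\zeta_i)}{z-\zeta_i}+\delta^\pm_M\frac{\mathcal B}{\chi'(0)}z\Bigr)+\mu\pm2\delta_M^\pm\,\frac{2\chi'(0)\mathcal B_1-\chi''(0)\mathcal B}{2\chi'(0)^2}.$$ -/

import Mathlib

open Filter Topology Asymptotics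
open scoped ContDiff

noncomputable section

/-! ### Residues and derivatives of Lie-algebra-valued fields -/

/-- Residue at `a` of the one-form `F(z) dz`, as `(2πi)⁻¹ ∮ F(z) dz` over small circles. -/
def residueAt (F : ℂ → ℂ) (a : ℂ) : ℂ :=
  limUnder (𝓝[>] (0 : ℝ))
    (fun r : ℝ => (2 * (Real.pi : ℂ) * Complex.I)⁻¹ * ∮ z in C(a, r), F z)

/-- Residue at infinity of the one-form `F(z) dz`, as `-(2πi)⁻¹ ∮ F(z) dz` over large circles. -/
def residueInfinity (F : ℂ → ℂ) : ℂ :=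
  limUnder atTop
    (fun r : ℝ => -((2 * (Real.pi : ℂ) * Complex.I)⁻¹ * ∮ z in C(0, r), F z))

section Fields

variable {V : Type*} [AddCommGroup V] [Module ℂ V]

/-- `v` is the derivative at `x` of the curve `g` in the finite-dimensional complex vector
space `V`; it is tested on linear forms, so that no norm on `V` has to be chosen. -/
def HasFieldDerivAt (g : ℝ → V) (v : V) (x : ℝ) : Prop :=
  ∀ l : Module.Dual ℂ V, HasDerivAt (fun y : ℝ => l (g y)) (l v) x

/-- A field on two-dimensional space-time, with arguments `t` and `x`, is smooth. -/
def IsSmoothField (g : ℝ → ℝ → V) : Prop :=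
  ∀ l : Module.Dual ℂ V, ContDiff ℝ ∞ (fun y : ℝ × ℝ => l (g y.1 y.2))

end Fields

/-- The opposite of the Killing form. -/
def kappa {𝔤 : Type*} [LieRing 𝔤] [LieAlgebra ℂ 𝔤] (X Y : 𝔤) : ℂ := -(killingForm ℂ 𝔤 X Y)

/-! ### Takiff data, twist function, Gaudin Lax matrix -/

/-- Parameters of a local affine Gaudin model with sites `S`: multiplicities `m`, pairwise distinct
positions, and levels. Only `level α p` with `p < m α` matters. The highest level of
each site is non-zero, and the first-class condition (the levels of the modes `0` add
up to zero) holds. -/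
structure GaudinDatum (S : Type*) [Fintype S] where
  m : S → ℕ
  m_pos : ∀ α, 1 ≤ m α
  pos : S → ℂ
  pos_injective : Function.Injective pos
  level : S → ℕ → ℂ
  level_top_ne_zero : ∀ α, level α (m α - 1) ≠ 0
  first_class : ∑ α, level α 0 = 0

namespace GaudinDatum

variable {S : Type*} [Fintype S] (D : GaudinDatum S)

/-- The twist function `φ`. -/
def twist (z : ℂ) : ℂ :=
  ∑ α, ∑ p ∈ Finset.range (D.m α), D.level α p / (z - D.pos α) ^ (p + 1)

/-- `χ(u) = -u⁻² φ(1/u)`, with its value at the removable singularity `u = 0` filled in. -/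
def chi : ℂ → ℂ :=
  Function.update (fun u : ℂ => -(1 / u ^ 2) * D.twist (1 / u)) 0
    (limUnder (𝓝[≠] (0 : ℂ)) (fun u : ℂ => -(1 / u ^ 2) * D.twist (1 / u)))

/-- The finite zeroes of `φ` are the pairwise distinct (hence simple) points `ζ i`, that is,
`φ(z) = -c ∏ (z - ζ i) / ∏ (z - z_α) ^ m_α` with a non-zero constant `c`. -/
def HasSimpleZeroes {n : ℕ} (ζ : Fin n → ℂ) : Prop :=
  Function.Injective ζ ∧ ∃ c : ℂ, c ≠ 0 ∧ ∀ z : ℂ, z ∉ Set.range D.pos →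
    D.twist z = -c * (∏ i, (z - ζ i)) / ∏ α, (z - D.pos α) ^ D.m α

variable {𝔤 : Type*} [LieRing 𝔤] [LieAlgebra ℂ 𝔤]

/-! The values at a space-time point of all the Takiff currents form an element
`J : S → ℕ → 𝔤`, in which only the entries `J α p` with `p < m α` matter. -/

/-- The Gaudin Lax matrix `Γ(z)`. -/
def gaudinLax (J : S → ℕ → 𝔤) (z : ℂ) : 𝔤 :=
  ∑ α, ∑ p ∈ Finset.range (D.m α), (1 / (z - D.pos α) ^ (p + 1)) • J α p

/-- The current `𝓒 = -res_{z=∞} Γ(z) dz`, which is the sum of the Takiff currents of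
mode `0`; the constraint is `𝓒 = 0`. -/
def constraint (_D : GaudinDatum S) (J : S → ℕ → 𝔤) : 𝔤 := ∑ α, J α 0

/-- `B` and `B₁` are the coefficients of the expansion
`Γ(1/u) = u 𝓒 - u² B - u³ B₁ + O(u⁴)` as `u → 0`; this determines them uniquely. -/
def HasExpansionAtInfinity (J : S → ℕ → 𝔤) (B B₁ : 𝔤) : Prop :=
  ∀ l : Module.Dual ℂ 𝔤,
    (fun u : ℂ => l (D.gaudinLax J (1 / u) - (u • D.constraint J - u ^ 2 • B - u ^ 3 • B₁)))
      =O[𝓝[≠] (0 : ℂ)] (fun u : ℂ => u ^ 4)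

/-! ### Hamiltonian dynamics -/

/-- The density `-κ(Γ(z), Γ(z)) / (2 φ(z))` of the spectral-parameter-dependent charge `𝓠(z)`. -/
def chargeDensity (J : S → ℕ → 𝔤) (z : ℂ) : ℂ :=
  -(kappa (D.gaudinLax J z) (D.gaudinLax J z)) / (2 * D.twist z)

/-- Case (i): density of the total Hamiltonian `∑ ε_i 𝓠_i + ∫ κ(μ, 𝓒)`, where `𝓠_i` is the
residue of `𝓠(z) dz` at `ζ_i`. -/
def hamiltonianI {M : ℕ} (ζ ε : Fin M → ℂ) (J : S → ℕ → 𝔤) (μ : 𝔤) : ℂ :=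
  ∑ i, ε i * residueAt (D.chargeDensity J) (ζ i) + kappa μ (D.constraint J)

/-- Case (ii), with `n = M - 1` finite zeroes; the last coefficient `ε_M` goes with the
zero at infinity. -/
def hamiltonianII {n : ℕ} (ζ : Fin n → ℂ) (ε : Fin (n + 1) → ℂ) (J : S → ℕ → 𝔤) (μ : 𝔤) : ℂ :=
  ∑ i : Fin n, ε i.castSucc * residueAt (D.chargeDensity J) (ζ i)
    + ε (Fin.last n) * residueInfinity (D.chargeDensity J)
    + kappa μ (D.constraint J)

/-- `f` is the gradient at `J`, with respect to `κ`, of the density `h`. Since the densities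
considered here contain no derivatives of the currents, `f α p` is the value of the functional
derivative of `∫ h dx` with respect to the current `J α p`. -/
def IsGradient [DecidableEq S] (h : (S → ℕ → 𝔤) → ℂ) (J f : S → ℕ → 𝔤) : Prop :=
  ∀ α, ∀ p < D.m α, ∀ X : 𝔤,
    HasDerivAt
      (fun s : ℂ => h (Function.update J α (Function.update (J α) p (J α p + s • X))))
      (kappa (f α p) X) 0

/-- The Takiff Poisson bracket `{H, J α q (x)}` for a functional `H` whose functional derivatives
at `x` are `f`, with `x`-derivatives `f'`. It is the bracket
`{J₁ α p (x), J₂ β q (y)} = δ_{αβ} ([C₁₂, J₁ α (p+q) (x)] δ_{xy} - level α (p+q) C₁₂ δ'_{xy})`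
for `p + q < m α`, and `0` otherwise, contracted with `f` in the first factor. -/
def takiffFlow (J f f' : S → ℕ → 𝔤) (α : S) (q : ℕ) : 𝔤 :=
  ∑ p ∈ (Finset.range (D.m α)).filter (fun p => p + q < D.m α),
    (⁅J α (p + q), f α p⁆ + D.level α (p + q) • f' α p)

/-- The currents `J t x α p` and the Lagrange multiplier `μ t x` form a solution of the
constrained dynamics with total Hamiltonian density `h`: the constraint holds and
`∂_t J = {H, J}`. -/
structure IsSolution [DecidableEq S] (h : (S → ℕ → 𝔤) → 𝔤 → ℂ)
    (J : ℝ → ℝ → S → ℕ → 𝔤) (μ : ℝ → ℝ → 𝔤) : Prop where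
  smooth_current : ∀ α, ∀ p < D.m α, IsSmoothField (fun t x => J t x α p)
  smooth_multiplier : IsSmoothField μ
  on_constraint_surface : ∀ t x, D.constraint (J t x) = 0
  evolution : ∃ f f' : ℝ → ℝ → S → ℕ → 𝔤,
    (∀ t x, D.IsGradient (fun K => h K (μ t x)) (J t x) (f t x)) ∧
    (∀ t x α, ∀ p < D.m α, HasFieldDerivAt (fun y => f t y α p) (f' t x α p) x) ∧
    (∀ t x α, ∀ q < D.m α,
      HasFieldDerivAt (fun s => J s x α q) (D.takiffFlow (J t x) (f t x) (f' t x) α q) t)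

/-! ### The Lax pair -/

/-- The spatial component `𝓛(z) = Γ(z) / φ(z)`. -/
def laxL (J : S → ℕ → 𝔤) (z : ℂ) : 𝔤 := (1 / D.twist z) • D.gaudinLax J z

/-- The contribution `Γ(ζ) / (φ'(ζ) (z - ζ))` of a finite zero `ζ`. -/
def zeroTerm (J : S → ℕ → 𝔤) (ζ z : ℂ) : 𝔤 :=
  (1 / deriv D.twist ζ * (1 / (z - ζ))) • D.gaudinLax J ζ

/-- The temporal component `𝓜(z)` in case (i). -/
def laxMI {M : ℕ} (ζ ε : Fin M → ℂ) (J : S → ℕ → 𝔤) (μ : 𝔤) (z : ℂ) : 𝔤 :=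
  ∑ i, ε i • D.zeroTerm J (ζ i) z + μ

/-- The temporal component `𝓜(z)` in case (ii). -/
def laxMII {n : ℕ} (ζ : Fin n → ℂ) (ε : Fin (n + 1) → ℂ) (J : S → ℕ → 𝔤) (μ : 𝔤) (z : ℂ) : 𝔤 :=
  ∑ i : Fin n, ε i.castSucc • D.zeroTerm J (ζ i) z
    + ε (Fin.last n) • (D.laxL J z - ∑ i : Fin n, D.zeroTerm J (ζ i) z) + μ

end GaudinDatum

/-- The zero curvature equation `∂_t L - ∂_x M + [M, L] = 0` at `(t, x)`; both derivatives exist. -/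
def ZeroCurvatureAt {𝔤 : Type*} [LieRing 𝔤] [LieAlgebra ℂ 𝔤] (M L : ℝ → ℝ → 𝔤) (t x : ℝ) :
    Prop :=
  ∃ dtL dxM : 𝔤, HasFieldDerivAt (fun s => L s x) dtL t ∧ HasFieldDerivAt (fun y => M t y) dxM x ∧
    dtL - dxM + ⁅M t x, L t x⁆ = 0

/-- The set `I_σ` of the indices `i` with `ε i = σ`, for `σ = ±1`. -/
def signSet {n : ℕ} (ε : Fin n → ℂ) (σ : ℂ) : Finset (Fin n) :=
  Finset.univ.filter (fun i => ε i = σ)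

end

/-! Why it is true. Varying `J α p` in a direction `X` varies Γ(z) by X/(z - z_α)^(p+1), so the
charge density varies by -κ(𝓛(z), X)/(z - z_α)^(p+1). On the constraint surface 𝓛 = Γ/φ has simple
poles only at the finite ζ_i, with residues R_i = Γ(ζ_i)/φ'(ζ_i), plus a polynomial part A + zV. The
residue at ζ_i then yields -R_i/(ζ_i - z_α)^(p+1), the p-th Taylor coefficient at z_α of R_i/(z -
ζ_i); the residue at infinity yields the Taylor coefficients of A + zV, and κ(μ, 𝓒) those of the
constant μ. Since κ is nondegenerate, the functional derivatives of the Hamiltonian are exactly the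
Taylor coefficients of 𝓜 at the sites (`gradient_hamiltonianI`, `gradient_hamiltonianII`).

Inserted into the Takiff bracket, these coefficients make ∂_t Γ(z) the sum of the principal parts at
the sites of [Γ, 𝓜] + φ ∂_x 𝓜. This function equals that sum: it has no pole at ζ_i, because
[Γ(ζ_i), R_i] = 0 and φ(ζ_i) = 0, and it has no constant term at infinity, because 𝓒 = 0 and the
levels of mode 0 add up to zero (`sum_smul_taylorGradient`, `sum_contract`,
`gaudinLax_takiffFlow_eq`). Division by φ gives the zero curvature equation.

The polynomial part of 𝓛 is read off at infinity: with z = 1/u and 𝓒 = 0, Γ/φ = (B + u B₁ +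
O(u²))/χ(u), which gives the constant B/χ(0) in case (i) and an affine function of z in case (ii)
(`div_twist_eq`). The light-cone formulas follow because ε_i ± 1 is ±2 on I_± and 0 elsewhere.
Vector identities are reduced to scalar ones by applying linear forms. -/

noncomputable section

namespace GaudinDatum

variable {S : Type*} [Fintype S] (D : GaudinDatum S)

/-! ### Scalar partial fractions with poles at the sites -/

/-- The rational function with coefficients `j` and poles at the sites. -/
def polarSum (j : S → ℕ → ℂ) (z : ℂ) : ℂ :=
  ∑ α, ∑ p ∈ Finset.range (D.m α), j α p / (z - D.pos α) ^ (p + 1)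

lemma twist_eq_polarSum : D.twist = D.polarSum D.level := rfl

lemma sub_pos_ne_zero {z : ℂ} (hz : z ∉ Set.range D.pos) (α : S) : z - D.pos α ≠ 0 :=
  fun h => hz ⟨α, (sub_eq_zero.mp h).symm⟩

/-- The common denominator of the rational functions with poles at the sites. -/
def poleProd (z : ℂ) : ℂ := ∏ α, (z - D.pos α) ^ D.m α

lemma poleProd_ne_zero {z : ℂ} (hz : z ∉ Set.range D.pos) : D.poleProd z ≠ 0 :=
  Finset.prod_ne_zero_iff.mpr fun α _ => pow_ne_zero _ (D.sub_pos_ne_zero hz α)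

lemma differentiable_poleProd : Differentiable ℂ D.poleProd := by
  unfold poleProd; fun_prop

lemma eventually_notMem_range_pos {z : ℂ} (hz : z ∉ Set.range D.pos) :
    ∀ᶠ y in 𝓝 z, y ∉ Set.range D.pos :=
  (Set.finite_range D.pos).isClosed.isOpen_compl.mem_nhds hz

/-- Clearing denominators. -/
lemma exists_numerator (j : S → ℕ → ℂ) : ∃ G : Polynomial ℂ,
    (∀ z, z ∉ Set.range D.pos → D.polarSum j z * D.poleProd z = G.eval z) ∧
    ∀ α, j α (D.m α - 1) ≠ 0 → G.eval (D.pos α) ≠ 0 := by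
  classical
  refine ⟨∑ α, ∑ p ∈ Finset.range (D.m α), Polynomial.C (j α p) *
    (Polynomial.X - Polynomial.C (D.pos α)) ^ (D.m α - 1 - p) *
    ∏ β ∈ Finset.univ.erase α, (Polynomial.X - Polynomial.C (D.pos β)) ^ D.m β, ?_, ?_⟩
  · intro z hz
    simp only [polarSum, Polynomial.eval_finsetSum, Polynomial.eval_mul, Polynomial.eval_C,
      Polynomial.eval_pow, Polynomial.eval_sub, Polynomial.eval_X, Polynomial.eval_prod,
      Finset.sum_mul]
    refine Finset.sum_congr rfl fun α _ => Finset.sum_congr rfl fun p hp => ?_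
    have hw := D.sub_pos_ne_zero hz α
    have hm : D.m α = (D.m α - 1 - p) + (p + 1) := by
      have := Finset.mem_range.mp hp; omega
    rw [poleProd, ← Finset.mul_prod_erase _ _ (Finset.mem_univ α)]
    nth_rw 1 [hm]
    rw [pow_add _ (D.m α - 1 - p), div_mul_eq_mul_div, div_eq_iff (pow_ne_zero _ hw)]
    ring
  · intro γ hγ
    have hm := D.m_pos γ
    simp only [Polynomial.eval_finsetSum, Polynomial.eval_mul, Polynomial.eval_C,
      Polynomial.eval_pow, Polynomial.eval_sub, Polynomial.eval_X, Polynomial.eval_prod]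
    -- At `pos γ` every summand contains a vanishing factor, except the one with `α = γ` and `p = m
    -- γ - 1`, where the exponent `m γ - 1 - p` is zero.
    rw [Finset.sum_eq_single γ, Finset.sum_eq_single (D.m γ - 1)]
    · rw [Nat.sub_self, pow_zero, mul_one]
      refine mul_ne_zero hγ (Finset.prod_ne_zero_iff.mpr fun β hβ => pow_ne_zero _ ?_)
      exact sub_ne_zero.mpr fun h => (Finset.ne_of_mem_erase hβ) (D.pos_injective h).symm
    · intro p hp hne
      have := Finset.mem_range.mp hp
      rw [sub_self, zero_pow (by omega)]; simp
    · intro h; exact absurd (Finset.mem_range.mpr (by omega)) h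
    · intro α _ hα
      refine Finset.sum_eq_zero fun p _ => ?_
      rw [Finset.prod_eq_zero (Finset.mem_erase.mpr ⟨hα.symm, Finset.mem_univ γ⟩), mul_zero]
      rw [sub_self, zero_pow (by omega)]
    · simp

/-! ### Zeroes of the twist function and partial fractions of `g / φ` -/

section Zeroes

variable {D} {n : ℕ} {ζ : Fin n → ℂ}

/-- The product formula for φ is only assumed away from the sites, so a cancellation between zeroes
and poles has to be excluded. The numerator of φ agrees with `-c ∏ (z - ζ i)` at infinitely many
points, hence as a polynomial, and it does not vanish at a site because the highest level there is
non-zero. -/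
lemma HasSimpleZeroes.notMem_range_pos (h : D.HasSimpleZeroes ζ) (i : Fin n) :
    ζ i ∉ Set.range D.pos := by
  obtain ⟨-, c, hc, hφ⟩ := h
  rintro ⟨α, hα⟩
  obtain ⟨G, hG, hG'⟩ := D.exists_numerator D.level
  have hpoly : G = Polynomial.C (-c) * Lagrange.nodal Finset.univ ζ := by
    refine Polynomial.eq_of_infinite_eval_eq _ _
      (Set.Infinite.mono ?_ (Set.finite_range D.pos).infinite_compl)
    intro z hz
    simp only [Set.mem_ofPred_eq, ← hG z hz, ← twist_eq_polarSum, hφ z hz, Polynomial.eval_mul,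
      Polynomial.eval_C, Lagrange.eval_nodal]
    exact div_mul_cancel₀ _ (D.poleProd_ne_zero hz)
  refine hG' α (D.level_top_ne_zero α) ?_
  rw [hpoly, hα, Polynomial.eval_mul, Lagrange.eval_nodal_at_node (Finset.mem_univ i), mul_zero]

lemma HasSimpleZeroes.twist_ne_zero (h : D.HasSimpleZeroes ζ) {z : ℂ}
    (hz : z ∉ Set.range D.pos) (hz' : z ∉ Set.range ζ) : D.twist z ≠ 0 := by
  obtain ⟨-, c, hc, hφ⟩ := h
  rw [hφ z hz]
  refine div_ne_zero (mul_ne_zero (neg_ne_zero.mpr hc) (Finset.prod_ne_zero_iff.mpr fun i _ => ?_))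
    (D.poleProd_ne_zero hz)
  exact fun h0 => hz' ⟨i, (sub_eq_zero.mp h0).symm⟩

lemma HasSimpleZeroes.twist_eq_zero (h : D.HasSimpleZeroes ζ) (i : Fin n) :
    D.twist (ζ i) = 0 := by
  have hi := h.notMem_range_pos i
  obtain ⟨-, c, hc, hφ⟩ := h
  rw [hφ _ hi, Finset.prod_eq_zero (Finset.mem_univ i) (sub_self _)]; simp

/-- At a zero only the derivative of the numerator contributes, and the derivative of the nodal
polynomial at a node is the inverse of the Lagrange weight. This matches φ' with the weights of the
interpolation formula. -/
lemma deriv_twist_zero {c : ℂ}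
    (hφ : ∀ z : ℂ, z ∉ Set.range D.pos →
      D.twist z = -c * (∏ i, (z - ζ i)) / ∏ α, (z - D.pos α) ^ D.m α) {i : Fin n}
    (hi : ζ i ∉ Set.range D.pos) :
    deriv D.twist (ζ i) =
      -c * (Lagrange.nodalWeight Finset.univ ζ i)⁻¹ / D.poleProd (ζ i) := by
  have hev : D.twist =ᶠ[𝓝 (ζ i)]
      fun z => (-c * (Lagrange.nodal Finset.univ ζ).eval z) / D.poleProd z := by
    filter_upwards [D.eventually_notMem_range_pos hi] with z hz
    rw [hφ z hz, Lagrange.eval_nodal, poleProd]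
  rw [hev.deriv_eq, Lagrange.nodalWeight_eq_eval_derivative_nodal (Finset.mem_univ i), inv_inv]
  have hP := D.poleProd_ne_zero hi
  have h1 := ((Lagrange.nodal Finset.univ ζ).hasDerivAt (ζ i)).const_mul (-c)
  rw [(h1.fun_div (D.differentiable_poleProd _).hasDerivAt hP).deriv,
    Lagrange.eval_nodal_at_node (Finset.mem_univ i)]
  field_simp
  ring

/-- Partial fractions of `g / φ`, with an unspecified polynomial part. -/
lemma HasSimpleZeroes.exists_polynomial_part (h : D.HasSimpleZeroes ζ) (j : S → ℕ → ℂ) :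
    ∃ K : Polynomial ℂ, ∀ z, z ∉ Set.range D.pos → z ∉ Set.range ζ →
      D.polarSum j z / D.twist z = K.eval z +
        ∑ i, 1 / deriv D.twist (ζ i) * (1 / (z - ζ i)) * D.polarSum j (ζ i) := by
  have hpos := h.notMem_range_pos
  obtain ⟨hinj, c, hc, hφ⟩ := h
  obtain ⟨G, hG, -⟩ := D.exists_numerator j
  set Q := Lagrange.nodal Finset.univ ζ with hQ
  -- The numerator minus its interpolant vanishes at all the distinct nodes, so `Q` divides it. The
  -- quotient gives the polynomial part; the interpolant divided by `Q`, in barycentric form, gives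
  -- the simple poles.
  have hdvd : Q ∣ G - Lagrange.interpolate Finset.univ ζ (fun i => G.eval (ζ i)) := by
    rw [hQ, Lagrange.nodal]
    refine Finset.prod_dvd_of_coprime (fun i _ k _ hik =>
      Polynomial.isCoprime_X_sub_C_of_isUnit_sub
        (sub_ne_zero.mpr (hinj.ne hik)).isUnit) fun i _ => ?_
    rw [Polynomial.dvd_iff_isRoot, Polynomial.IsRoot, Polynomial.eval_sub,
      Lagrange.eval_interpolate_at_node _ hinj.injOn (Finset.mem_univ i), sub_self]
  obtain ⟨K, hK⟩ := hdvd
  refine ⟨Polynomial.C (-c)⁻¹ * K, fun z hz hz' => ?_⟩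
  have hzi : ∀ i, z ≠ ζ i := fun i hi => hz' ⟨i, hi.symm⟩
  have hGz : G.eval z = Q.eval z * K.eval z + Q.eval z *
      ∑ i, Lagrange.nodalWeight Finset.univ ζ i * (z - ζ i)⁻¹ * G.eval (ζ i) := by
    have := congrArg (Polynomial.eval z) hK
    rw [Polynomial.eval_sub, Polynomial.eval_mul,
      Lagrange.eval_interpolate_not_at_node _ (fun i _ => hzi i), sub_eq_iff_eq_add] at this
    exact this
  have hP := D.poleProd_ne_zero hz
  have hQz : Q.eval z ≠ 0 := by
    rw [hQ, Lagrange.eval_nodal]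
    exact Finset.prod_ne_zero_iff.mpr fun i _ => sub_ne_zero.mpr (hzi i)
  have h1 : D.polarSum j z / D.twist z = (-c)⁻¹ * (G.eval z / Q.eval z) := by
    rw [hφ z hz, ← hG z hz, hQ, Lagrange.eval_nodal] at *
    change D.polarSum j z / (_ / D.poleProd z) = _
    field_simp
  rw [h1, hGz, ← mul_add, mul_div_cancel_left₀ _ hQz, mul_add, Polynomial.eval_mul,
    Polynomial.eval_C, Finset.mul_sum]
  congr 1
  refine Finset.sum_congr rfl fun i _ => ?_
  have hw := Lagrange.nodalWeight_ne_zero hinj.injOn (Finset.mem_univ i)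
  have hPi := D.poleProd_ne_zero (hpos i)
  rw [deriv_twist_zero hφ (hpos i), ← hG _ (hpos i)]
  have := sub_ne_zero.mpr (hzi i)
  field_simp

end Zeroes

/-- A polynomial that tends to zero at infinity is zero. -/
lemma _root_.Polynomial.eq_zero_of_tendsto_inv {K : Polynomial ℂ}
    (h : Tendsto (fun u : ℂ => K.eval u⁻¹) (𝓝[≠] 0) (𝓝 0)) : K = 0 := by
  by_cases hd : 0 < K.degree
  · exact absurd h.norm (not_tendsto_nhds_of_tendsto_atTop
      (K.tendsto_norm_atTop hd (tendsto_norm_inv_nhdsNE_zero_atTop)) _)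
  · rw [Polynomial.eq_C_of_degree_le_zero (not_lt.mp hd)] at h ⊢
    simp only [Polynomial.eval_C] at h
    rw [tendsto_nhds_unique tendsto_const_nhds h, Polynomial.C_0]

/-! ### Expansion at infinity -/

/-- `u⁻² (1/u - a)^{-(p+1)}`, without the term `u⁻¹` present for `p = 0`. -/
def infTerm (a : ℂ) (p : ℕ) (u : ℂ) : ℂ :=
  if p = 0 then a / (1 - a * u) else u ^ (p - 1) / (1 - a * u) ^ (p + 1)

lemma analyticAt_infTerm (a : ℂ) (p : ℕ) : AnalyticAt ℂ (infTerm a p) 0 := by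
  unfold infTerm
  split_ifs with h
  · exact analyticAt_const.div (by fun_prop) (by simp)
  · exact (by fun_prop : AnalyticAt ℂ (fun u : ℂ => u ^ (p - 1)) 0).div (by fun_prop) (by simp)

lemma one_div_sub_pow_eq {a u : ℂ} (p : ℕ) (hu : u ≠ 0) (ha : 1 - a * u ≠ 0) :
    1 / (1 / u - a) ^ (p + 1) = (if p = 0 then u else 0) + u ^ 2 * infTerm a p u := by
  have h1 : 1 / u - a = (1 - a * u) / u := by field_simp
  rw [h1, div_pow, one_div_div, infTerm]
  rcases p with _ | p
  · simp only [if_true]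
    field_simp
    ring
  · simp only [Nat.succ_ne_zero, if_false, Nat.add_sub_cancel]
    field_simp
    ring

/-- The second-order remainder at infinity of `polarSum`. -/
def infSum (j : S → ℕ → ℂ) (u : ℂ) : ℂ :=
  ∑ α, ∑ p ∈ Finset.range (D.m α), j α p * infTerm (D.pos α) p u

lemma analyticAt_infSum (j : S → ℕ → ℂ) : AnalyticAt ℂ (D.infSum j) 0 := by
  unfold infSum
  exact Finset.analyticAt_fun_sum _ fun α _ => Finset.analyticAt_fun_sum _ fun p _ =>
    analyticAt_const.mul (analyticAt_infTerm _ _)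

lemma deriv_infSum (j : S → ℕ → ℂ) : deriv (D.infSum j) 0 =
    ∑ α, ∑ p ∈ Finset.range (D.m α), j α p * deriv (infTerm (D.pos α) p) 0 := by
  refine HasDerivAt.deriv ?_
  unfold infSum
  exact HasDerivAt.fun_sum fun α _ => HasDerivAt.fun_sum fun p _ =>
    (analyticAt_infTerm _ _).differentiableAt.hasDerivAt.const_mul _

lemma eventually_polarSum_inv (j : S → ℕ → ℂ) : ∀ᶠ u in 𝓝[≠] (0 : ℂ),
    D.polarSum j (1 / u) = u * ∑ α, j α 0 + u ^ 2 * D.infSum j u := by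
  have h1 : ∀ᶠ u in 𝓝 (0 : ℂ), ∀ α, 1 - D.pos α * u ≠ 0 := by
    refine Filter.eventually_all.mpr fun α => ?_
    have : ContinuousAt (fun u : ℂ => 1 - D.pos α * u) 0 := by fun_prop
    exact this.eventually_ne (by simp)
  filter_upwards [h1.filter_mono nhdsWithin_le_nhds, self_mem_nhdsWithin] with u hu hu0
  simp only [polarSum, infSum, Finset.mul_sum, ← Finset.sum_add_distrib]
  refine Finset.sum_congr rfl fun α _ => ?_
  have : u * j α 0 = ∑ p ∈ Finset.range (D.m α), j α p * (if p = 0 then u else 0) := by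
    rw [Finset.sum_eq_single 0]
    · simp [mul_comm]
    · intro b _ hb; simp [hb]
    · intro h; exact absurd (Finset.mem_range.mpr (D.m_pos α)) h
  rw [this, ← Finset.sum_add_distrib]
  refine Finset.sum_congr rfl fun p _ => ?_
  rw [div_eq_mul_one_div, one_div_sub_pow_eq p hu0 (hu α)]
  ring

/-- The first-class condition removes the term of order `u` from φ(1/u), leaving `u ^ 2` times an
analytic function; hence the singularity of χ is removable. -/
lemma chi_eventuallyEq : D.chi =ᶠ[𝓝 0] fun u => -D.infSum D.level u := by
  have h1 : ∀ᶠ u in 𝓝[≠] (0 : ℂ), -(1 / u ^ 2) * D.twist (1 / u) = -D.infSum D.level u := by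
    filter_upwards [D.eventually_polarSum_inv D.level, self_mem_nhdsWithin] with u hu hu0
    rw [twist_eq_polarSum, hu, D.first_class]
    have : u ≠ 0 := hu0
    field_simp
    ring
  have h2 : limUnder (𝓝[≠] (0 : ℂ)) (fun u : ℂ => -(1 / u ^ 2) * D.twist (1 / u)) =
      -D.infSum D.level 0 := by
    refine Tendsto.limUnder_eq (Tendsto.congr' (EventuallyEq.symm h1) ?_)
    exact (D.analyticAt_infSum _).continuousAt.neg.tendsto.mono_left nhdsWithin_le_nhds
  have h3 := eventually_nhdsWithin_iff.mp h1
  filter_upwards [h3] with u hu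
  rw [chi]
  by_cases hu0 : u = 0
  · subst hu0
    rw [Function.update_self, h2]
  · rw [Function.update_of_ne hu0, hu hu0]

lemma analyticAt_chi : AnalyticAt ℂ D.chi 0 :=
  (D.analyticAt_infSum _).neg.congr D.chi_eventuallyEq.symm

lemma isBigO_infSum (j : S → ℕ → ℂ) :
    (fun u : ℂ => D.infSum j u - (D.infSum j 0 + u * deriv (D.infSum j) 0))
      =O[𝓝 0] fun u => u ^ 2 := by
  have h := (D.analyticAt_infSum j).hasFPowerSeriesAt.isBigO_sub_partialSum_pow 2
  simp only [zero_add] at h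
  refine (h.congr_left fun u => ?_).trans
    ((isBigO_refl _ _).norm_left.congr_left fun u => by simp)
  simp [FormalMultilinearSeries.partialSum, Finset.sum_range_succ, mul_comm]

/-- Passing to `dslope` at 0 shifts the Taylor coefficients by one, so the new linear coefficient is
the old quadratic one. -/
lemma deriv_dslope_zero {f : ℂ → ℂ} (hf : AnalyticAt ℂ f 0) :
    AnalyticAt ℂ (dslope f 0) 0 ∧ deriv (dslope f 0) 0 = iteratedDeriv 2 f 0 / 2 := by
  have h := hf.hasFPowerSeriesAt.has_fpower_series_dslope_fslope
  refine ⟨⟨_, h⟩, ?_⟩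
  rw [h.deriv]
  have : (FormalMultilinearSeries.fslope (FormalMultilinearSeries.ofScalars ℂ
      fun n => iteratedDeriv n f 0 / (n.factorial : ℂ))).coeff 1 = iteratedDeriv 2 f 0 / 2 := by
    rw [FormalMultilinearSeries.coeff_fslope, FormalMultilinearSeries.coeff_ofScalars]
    norm_num
  exact this

lemma tendsto_one_div_inv_sub (a : ℂ) :
    Tendsto (fun u : ℂ => 1 / (u⁻¹ - a)) (𝓝[≠] 0) (𝓝 0) := by
  have h : ContinuousAt (fun u : ℂ => u / (1 - a * u)) 0 :=
    ContinuousAt.div (by fun_prop) (by fun_prop) (by simp)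
  have h2 := h.tendsto.mono_left (nhdsWithin_le_nhds (s := {0}ᶜ))
  simp only [zero_div] at h2
  refine h2.congr' ?_
  filter_upwards [self_mem_nhdsWithin] with u hu
  have : u ≠ 0 := hu
  have h1 : u⁻¹ - a = (1 - a * u) / u := by field_simp
  rw [h1, one_div_div]

/-! ### The polynomial part of `g / φ` -/

section Zeroes

variable {D} {n : ℕ} {ζ : Fin n → ℂ}

/-- Identification of the polynomial part of `g / φ` from the behaviour at infinity. -/
lemma HasSimpleZeroes.div_twist_eq (h : D.HasSimpleZeroes ζ) (j : S → ℕ → ℂ)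
    (hj : ∑ α, j α 0 = 0) {A V : ℂ}
    (hlim : Tendsto (fun u => -D.infSum j u / D.chi u - V * u⁻¹) (𝓝[≠] 0) (𝓝 A)) {z : ℂ}
    (hz : z ∉ Set.range D.pos) (hz' : z ∉ Set.range ζ) :
    D.polarSum j z / D.twist z =
      ∑ i, 1 / deriv D.twist (ζ i) * (1 / (z - ζ i)) * D.polarSum j (ζ i) + (A + V * z) := by
  obtain ⟨K, hK⟩ := h.exists_polynomial_part j
  -- The pole terms vanish at infinity, so `hlim` says that this polynomial tends to zero there,
  -- which forces it to be zero.
  suffices hKeq : K - (Polynomial.C A + Polynomial.C V * Polynomial.X) = 0 by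
    rw [hK z hz hz', sub_eq_zero.mp hKeq]
    simp
    ring
  apply Polynomial.eq_zero_of_tendsto_inv
  have hsum : Tendsto (fun u : ℂ => ∑ i, 1 / deriv D.twist (ζ i) * (1 / (u⁻¹ - ζ i)) *
      D.polarSum j (ζ i)) (𝓝[≠] 0) (𝓝 0) := by
    have := tendsto_finsetSum (Finset.univ : Finset (Fin n)) fun i _ =>
      ((tendsto_one_div_inv_sub (ζ i)).const_mul (1 / deriv D.twist (ζ i))).mul_const
        (D.polarSum j (ζ i))
    simpa using this
  have hmain := (hlim.sub hsum).sub_const A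
  simp only [sub_zero, sub_self] at hmain
  refine hmain.congr' ?_
  have hbad : ∀ᶠ u in 𝓝[≠] (0 : ℂ), u⁻¹ ∉ Set.range D.pos ∪ Set.range ζ := by
    have hfin := ((Set.finite_range D.pos).union (Set.finite_range ζ)).isBounded
    have := (Filter.tendsto_inv₀_nhdsNE_zero (α := ℂ)).eventually
      (Bornology.isBounded_def.mp hfin)
    exact this
  filter_upwards [hbad, D.eventually_polarSum_inv j, D.eventually_polarSum_inv D.level,
    D.chi_eventuallyEq.filter_mono nhdsWithin_le_nhds, self_mem_nhdsWithin]
    with u hu h1 h2 h3 hu0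
  have hu0 : u ≠ 0 := hu0
  rw [Set.mem_union, not_or] at hu
  have h4 := hK u⁻¹ hu.1 hu.2
  rw [← one_div, h1, twist_eq_polarSum, h2, hj, D.first_class, ← twist_eq_polarSum, mul_zero,
    zero_add, zero_add, mul_div_mul_left _ _ (pow_ne_zero 2 hu0), one_div] at h4
  rw [Polynomial.eval_sub, h3, neg_div_neg_eq, h4]
  simp only [one_div, Polynomial.eval_add, Polynomial.eval_C, Polynomial.eval_mul,
    Polynomial.eval_X]
  ring

lemma tendsto_of_chi_ne_zero (j : S → ℕ → ℂ) (hχ : D.chi 0 ≠ 0) :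
    Tendsto (fun u => -D.infSum j u / D.chi u - 0 * u⁻¹) (𝓝[≠] 0)
      (𝓝 (-D.infSum j 0 / D.chi 0)) := by
  have h : ContinuousAt (fun u => -D.infSum j u / D.chi u) 0 :=
    (D.analyticAt_infSum j).continuousAt.neg.div D.analyticAt_chi.continuousAt hχ
  simpa using h.tendsto.mono_left (nhdsWithin_le_nhds (s := {0}ᶜ))

/-- Writing χ(u) = u ψ(u) with ψ = `dslope D.chi 0`, the expression becomes the difference quotient
at 0 of `-infSum / ψ`. The limit is therefore given by the quotient rule with ψ(0) = χ'(0) and ψ'(0)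
= χ''(0)/2. -/
lemma tendsto_of_chi_eq_zero (j : S → ℕ → ℂ) (hχ : D.chi 0 = 0) (hχ' : deriv D.chi 0 ≠ 0) :
    Tendsto (fun u => -D.infSum j u / D.chi u - -D.infSum j 0 / deriv D.chi 0 * u⁻¹) (𝓝[≠] 0)
      (𝓝 (1 / (2 * deriv D.chi 0 ^ 2) * (2 * deriv D.chi 0 * -deriv (D.infSum j) 0 -
        iteratedDeriv 2 D.chi 0 * -D.infSum j 0))) := by
  obtain ⟨han, hd⟩ := deriv_dslope_zero D.analyticAt_chi
  have h0 : dslope D.chi 0 0 = deriv D.chi 0 := dslope_same _ _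
  have h := (D.analyticAt_infSum j).differentiableAt.hasDerivAt.neg.div
    han.differentiableAt.hasDerivAt (by rwa [h0])
  have h2 := hasDerivAt_iff_tendsto_slope.mp h
  convert h2.congr' ?_ using 2
  · rw [h0, hd]
    simp only [Pi.neg_apply]
    field_simp
  · filter_upwards [self_mem_nhdsWithin] with u hu
    have hu : u ≠ 0 := hu
    have h3 : D.chi u = u * dslope D.chi 0 u := by
      have := sub_smul_dslope D.chi 0 u
      simpa [hχ] using this.symm
    rw [slope_def_field, h3]
    simp only [Pi.div_apply, Pi.neg_apply, h0, sub_zero]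
    rw [sub_div, div_div, mul_comm u, div_eq_mul_inv (_ / deriv D.chi 0) u]

end Zeroes

/-! ### The Lax matrix: expansion at infinity and partial fractions -/

section LieValued

variable {𝔤 : Type*} [LieRing 𝔤] [LieAlgebra ℂ 𝔤]

lemma dual_gaudinLax (l : Module.Dual ℂ 𝔤) (J : S → ℕ → 𝔤) (z : ℂ) :
    l (D.gaudinLax J z) = D.polarSum (fun α p => l (J α p)) z := by
  simp only [gaudinLax, polarSum, map_sum, map_smul, smul_eq_mul]
  refine Finset.sum_congr rfl fun α _ => Finset.sum_congr rfl fun p _ => ?_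
  ring

lemma dual_constraint (l : Module.Dual ℂ 𝔤) (J : S → ℕ → 𝔤) :
    l (D.constraint J) = ∑ α, l (J α 0) := by
  simp [constraint]

/-- The coefficient `B` of `Γ(1/u) = u C - u² B - u³ B₁ + O(u⁴)`. -/
def coeffB (J : S → ℕ → 𝔤) : 𝔤 :=
  -∑ α, ∑ p ∈ Finset.range (D.m α), infTerm (D.pos α) p 0 • J α p

/-- The coefficient `B₁` of `Γ(1/u) = u C - u² B - u³ B₁ + O(u⁴)`. -/
def coeffB₁ (J : S → ℕ → 𝔤) : 𝔤 :=
  -∑ α, ∑ p ∈ Finset.range (D.m α), deriv (infTerm (D.pos α) p) 0 • J α p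

lemma dual_coeffB (l : Module.Dual ℂ 𝔤) (J : S → ℕ → 𝔤) :
    l (D.coeffB J) = -D.infSum (fun α p => l (J α p)) 0 := by
  simp [coeffB, infSum, mul_comm]

lemma dual_coeffB₁ (l : Module.Dual ℂ 𝔤) (J : S → ℕ → 𝔤) :
    l (D.coeffB₁ J) = -deriv (D.infSum fun α p => l (J α p)) 0 := by
  simp [coeffB₁, deriv_infSum, mul_comm]

lemma hasExpansionAtInfinity (J : S → ℕ → 𝔤) :
    D.HasExpansionAtInfinity J (D.coeffB J) (D.coeffB₁ J) := by
  intro l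
  have h := (isBigO_refl (fun u : ℂ => u ^ 2) (𝓝[≠] 0)).mul
    ((D.isBigO_infSum fun α p => l (J α p)).mono (nhdsWithin_le_nhds (s := {0}ᶜ)))
  refine h.congr' ?_ (Eventually.of_forall fun u => by ring)
  filter_upwards [D.eventually_polarSum_inv fun α p => l (J α p)] with u hu
  simp only [map_sub, map_smul, smul_eq_mul, dual_gaudinLax, dual_constraint, dual_coeffB,
    dual_coeffB₁, hu]
  ring

/-- Linear forms separate points, so the partial fractions of 𝓛 follow from those with scalar
coefficients `l (J α p)`. -/
lemma eq_of_forall_dual {v w : 𝔤} (h : ∀ l : Module.Dual ℂ 𝔤, l v = l w) : v = w := by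
  rw [← sub_eq_zero, ← Module.forall_dual_apply_eq_zero_iff ℂ]
  intro l
  rw [map_sub, h l, sub_self]

variable {D} {n : ℕ} {ζ : Fin n → ℂ}

/-- Partial fractions of `Γ / φ` when the twist function has a double pole at infinity. -/
lemma HasSimpleZeroes.laxL_eq_of_chi_ne_zero (h : D.HasSimpleZeroes ζ) (hχ : D.chi 0 ≠ 0)
    {J : S → ℕ → 𝔤} (hC : D.constraint J = 0) {z : ℂ}
    (hz : z ∉ Set.range D.pos) (hz' : z ∉ Set.range ζ) :
    D.laxL J z = ∑ i, D.zeroTerm J (ζ i) z + (1 / D.chi 0) • D.coeffB J := by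
  refine eq_of_forall_dual fun l => ?_
  have := h.div_twist_eq (fun α p => l (J α p)) (by rw [← D.dual_constraint, hC, map_zero])
    (tendsto_of_chi_ne_zero _ hχ) hz hz'
  simp only [laxL, zeroTerm, map_add, map_sum, map_smul, smul_eq_mul, dual_gaudinLax, dual_coeffB]
  rw [one_div_mul_eq_div, this]
  ring

/-- Partial fractions of `Γ / φ` when the twist function has a triple zero at infinity. -/
lemma HasSimpleZeroes.laxL_eq_of_chi_eq_zero (h : D.HasSimpleZeroes ζ) (hχ : D.chi 0 = 0)
    (hχ' : deriv D.chi 0 ≠ 0) {J : S → ℕ → 𝔤} (hC : D.constraint J = 0) {z : ℂ}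
    (hz : z ∉ Set.range D.pos) (hz' : z ∉ Set.range ζ) :
    D.laxL J z = ∑ i, D.zeroTerm J (ζ i) z +
      ((1 / (2 * deriv D.chi 0 ^ 2)) •
          ((2 * deriv D.chi 0) • D.coeffB₁ J - iteratedDeriv 2 D.chi 0 • D.coeffB J) +
        z • (1 / deriv D.chi 0) • D.coeffB J) := by
  refine eq_of_forall_dual fun l => ?_
  have := h.div_twist_eq (fun α p => l (J α p)) (by rw [← D.dual_constraint, hC, map_zero])
    (tendsto_of_chi_eq_zero _ hχ hχ') hz hz'
  simp only [laxL, zeroTerm, map_add, map_sub, map_sum, map_smul, smul_eq_mul, dual_gaudinLax,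
    dual_coeffB, dual_coeffB₁]
  rw [one_div_mul_eq_div, this]
  ring

/-! ### Light-cone components -/

/-- For two signs, `ε i + σ` is `2 * σ` if they agree and zero otherwise. -/
lemma sum_signs_smul_add {ε : Fin n → ℂ} (hε : ∀ i, ε i ^ 2 = 1) {σ : ℂ} (hσ : σ = 1 ∨ σ = -1)
    (Z : Fin n → 𝔤) :
    ∑ i, ε i • Z i + σ • ∑ i, Z i = (2 * σ) • ∑ i ∈ signSet ε σ, Z i := by
  rw [signSet, Finset.sum_filter, Finset.smul_sum, Finset.smul_sum, ← Finset.sum_add_distrib]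
  refine Finset.sum_congr rfl fun i _ => ?_
  rw [← add_smul]
  split_ifs with h
  · rw [h, two_mul]
  · have : ε i + σ = 0 := by
      rcases sq_eq_one_iff.mp (hε i) with h1 | h1 <;>
        rcases hσ with h2 | h2 <;> simp_all
    rw [this, zero_smul, smul_zero]

lemma HasSimpleZeroes.lightCone_of_chi_ne_zero (h : D.HasSimpleZeroes ζ) (hχ : D.chi 0 ≠ 0)
    {ε : Fin n → ℂ} (hε : ∀ i, ε i ^ 2 = 1) {J : S → ℕ → 𝔤} (μ : 𝔤)
    (hC : D.constraint J = 0) {z : ℂ} (hz : z ∉ Set.range D.pos) (hz' : z ∉ Set.range ζ)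
    {σ : ℂ} (hσ : σ = 1 ∨ σ = -1) :
    D.laxMI ζ ε J μ z + σ • D.laxL J z =
      (2 * σ) • ∑ i ∈ signSet ε σ,
          (1 / deriv D.twist (ζ i) * (1 / (z - ζ i))) • D.gaudinLax J (ζ i)
        + μ + (σ / D.chi 0) • D.coeffB J := by
  have h1 := sum_signs_smul_add hε hσ fun i => D.zeroTerm J (ζ i) z
  change _ = (2 * σ) • ∑ i ∈ signSet ε σ, D.zeroTerm J (ζ i) z + μ + _
  rw [← h1, laxMI, h.laxL_eq_of_chi_ne_zero hχ hC hz hz', smul_add, smul_smul, mul_one_div]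
  abel

lemma HasSimpleZeroes.lightCone_of_chi_eq_zero (h : D.HasSimpleZeroes ζ) (hχ : D.chi 0 = 0)
    (hχ' : deriv D.chi 0 ≠ 0) {ε : Fin (n + 1) → ℂ} (hε : ∀ i, ε i ^ 2 = 1)
    {J : S → ℕ → 𝔤} (μ : 𝔤) (hC : D.constraint J = 0) {z : ℂ}
    (hz : z ∉ Set.range D.pos) (hz' : z ∉ Set.range ζ) {σ : ℂ} (hσ : σ = 1 ∨ σ = -1) :
    D.laxMII ζ ε J μ z + σ • D.laxL J z =
      (2 * σ) •
          (∑ i ∈ signSet (fun i : Fin n => ε i.castSucc) σ,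
              (1 / deriv D.twist (ζ i) * (1 / (z - ζ i))) • D.gaudinLax J (ζ i)
            + (if Fin.last n ∈ signSet ε σ then (1 : ℂ) else 0) •
                (z / deriv D.chi 0) • D.coeffB J)
        + μ
        + (2 * σ * (if Fin.last n ∈ signSet ε σ then (1 : ℂ) else 0)) •
            (1 / (2 * deriv D.chi 0 ^ 2)) •
              ((2 * deriv D.chi 0) • D.coeffB₁ J - iteratedDeriv 2 D.chi 0 • D.coeffB J) := by
  have h1 := sum_signs_smul_add (fun i : Fin n => hε i.castSucc) hσ
    fun i => D.zeroTerm J (ζ i) z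
  have h2 : ε (Fin.last n) + σ = 2 * σ * (if Fin.last n ∈ signSet ε σ then (1 : ℂ) else 0) := by
    rcases sq_eq_one_iff.mp (hε (Fin.last n)) with h1 | h1 <;>
      rcases hσ with h2 | h2 <;> simp [signSet, h1, h2] <;> norm_num
  change _ = (2 * σ) • (∑ i ∈ signSet (fun i : Fin n => ε i.castSucc) σ, D.zeroTerm J (ζ i) z + _)
    + μ + _
  rw [smul_add, smul_smul (2 * σ), ← h1, ← h2, laxMII, h.laxL_eq_of_chi_eq_zero hχ hχ' hC hz hz',
    div_eq_mul_one_div z, ← smul_smul z]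
  set A := (1 / (2 * deriv D.chi 0 ^ 2)) •
    ((2 * deriv D.chi 0) • D.coeffB₁ J - iteratedDeriv 2 D.chi 0 • D.coeffB J)
  module

end LieValued

/-! ### Residues as integrals over fixed circles -/

/-- Normalized integral over a circle. -/
def _root_.circleResidue (c : ℂ) (r : ℝ) (F : ℂ → ℂ) : ℂ :=
  (2 * (Real.pi : ℂ) * Complex.I)⁻¹ * ∮ z in C(c, r), F z

-- By Cauchy's theorem on annuli the normalized integral is the same over all smaller circles, so
-- the limit is that of an eventually constant function. A fixed circle can then serve for all
-- currents at once, as differentiation in the currents requires.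
open Metric in
lemma _root_.residueAt_eq_circleResidue {F : ℂ → ℂ} {a : ℂ} {r : ℝ} (hr : 0 < r)
    (hF : ∀ z ∈ closedBall a r, z ≠ a → DifferentiableAt ℂ F z) :
    residueAt F a = circleResidue a r F := by
  refine Tendsto.limUnder_eq (tendsto_const_nhds.congr' ?_)
  filter_upwards [Ioc_mem_nhdsGT hr] with t ht
  rw [circleResidue]
  congr 1
  refine Complex.circleIntegral_eq_of_differentiable_on_annulus_off_countable ht.1 ht.2
    Set.countable_empty (fun z hz => ?_) fun z hz => ?_
  · refine (hF z hz.1 ?_).continuousAt.continuousWithinAt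
    rintro rfl; exact hz.2 (mem_ball_self ht.1)
  · refine hF z (ball_subset_closedBall hz.1.1) ?_
    rintro rfl; exact hz.1.2 (mem_closedBall_self ht.1.le)

open Metric in
lemma _root_.residueInfinity_eq_circleResidue {F : ℂ → ℂ} {R : ℝ} (hR : 0 < R)
    (hF : ∀ z : ℂ, R ≤ ‖z‖ → DifferentiableAt ℂ F z) :
    residueInfinity F = -circleResidue 0 R F := by
  refine Tendsto.limUnder_eq (tendsto_const_nhds.congr' ?_)
  filter_upwards [eventually_ge_atTop R] with t ht
  rw [circleResidue]
  congr 2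
  refine (Complex.circleIntegral_eq_of_differentiable_on_annulus_off_countable hR ht
    Set.countable_empty (fun z hz => ?_) fun z hz => ?_).symm
  · refine (hF z ?_).continuousAt.continuousWithinAt
    simpa using hz.2
  · refine hF z ?_
    have := hz.1.2
    simp only [mem_closedBall, dist_zero_right, not_le] at this
    exact this.le

/-- The integrand is quadratic in `s`, so linearity of the integral suffices and no differentiation
under the integral sign is needed. -/
lemma _root_.hasDerivAt_circleResidue {c : ℂ} {r : ℝ} (hr : 0 ≤ r) {F : ℂ → ℂ → ℂ}
    {F₀ F₁ F₂ : ℂ → ℂ} (h₀ : ContinuousOn F₀ (Metric.sphere c r))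
    (h₁ : ContinuousOn F₁ (Metric.sphere c r)) (h₂ : ContinuousOn F₂ (Metric.sphere c r))
    (hF : ∀ s, ∀ z ∈ Metric.sphere c r, F s z = F₀ z + s * F₁ z + s ^ 2 * F₂ z) :
    HasDerivAt (fun s => circleResidue c r (F s)) (circleResidue c r F₁) 0 := by
  have i₀ := h₀.circleIntegrable hr
  have i₁ := h₁.circleIntegrable hr
  have i₂ := h₂.circleIntegrable hr
  have h : (fun s => circleResidue c r (F s)) = fun s =>
      circleResidue c r F₀ + s * circleResidue c r F₁ + s ^ 2 * circleResidue c r F₂ := by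
    ext s
    simp only [circleResidue]
    have h3 : (∮ z in C(c, r), F s z) =
        (∮ z in C(c, r), F₀ z) + s * (∮ z in C(c, r), F₁ z) + s ^ 2 * ∮ z in C(c, r), F₂ z := by
      rw [circleIntegral.integral_congr hr (hF s), circleIntegral.integral_add,
        circleIntegral.integral_add i₀, circleIntegral.integral_const_mul,
        circleIntegral.integral_const_mul]
      · exact ((continuousOn_const (c := s)).mul h₁).circleIntegrable hr
      · exact (h₀.add ((continuousOn_const (c := s)).mul h₁)).circleIntegrable hr
      · exact ((continuousOn_const (c := s ^ 2)).mul h₂).circleIntegrable hr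
    rw [h3]
    ring
  rw [h]
  have hd := (((hasDerivAt_id' (0 : ℂ)).mul_const (circleResidue c r F₁)).const_add
    (circleResidue c r F₀)).fun_add
      (((hasDerivAt_id' (0 : ℂ)).fun_pow 2).mul_const (circleResidue c r F₂))
  simpa using hd

lemma _root_.exists_isolating_radius {s : Set ℂ} (hs : s.Finite) (a : ℂ) :
    ∃ r > 0, ∀ z ∈ Metric.closedBall a r, z ≠ a → z ∉ s := by
  have h : (s \ {a})ᶜ ∈ 𝓝 a := (hs.sdiff (t := {a})).isClosed.isOpen_compl.mem_nhds (by simp)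
  obtain ⟨r, hr, h⟩ := Metric.nhds_basis_closedBall.mem_iff.mp h
  exact ⟨r, hr, fun z hz hne hzs => h hz ⟨hzs, hne⟩⟩

lemma _root_.exists_enclosing_radius {s : Set ℂ} (hs : s.Finite) :
    ∃ R > 0, ∀ z ∈ s, ‖z‖ < R := by
  obtain ⟨R, hR, h⟩ := hs.isBounded.exists_pos_norm_lt
  exact ⟨R, hR, h⟩

lemma _root_.circleResidue_zero_kernel {n : ℕ} {ζ ρ : Fin n → ℂ} {a b v : ℂ} {r : ℝ} {i : Fin n}
    (hr : 0 < r) (p : ℕ) (ha : a ∉ Metric.closedBall (ζ i) r)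
    (hζ : ∀ k ≠ i, ζ k ∉ Metric.closedBall (ζ i) r) :
    circleResidue (ζ i) r (fun z => (∑ k, ρ k / (z - ζ k) + (b + v * z)) / (z - a) ^ (p + 1)) =
      ρ i / (ζ i - a) ^ (p + 1) := by
  -- This is the integrand times `z - ζ i`, with the pole removed; Cauchy's formula evaluates it at
  -- the centre.
  set g : ℂ → ℂ := fun z => (ρ i + (z - ζ i) * (∑ k ∈ Finset.univ.erase i, ρ k / (z - ζ k) +
    (b + v * z))) / (z - a) ^ (p + 1) with hg
  have hgd : DifferentiableOn ℂ g (Metric.closedBall (ζ i) r) := by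
    intro z hz
    refine DifferentiableAt.differentiableWithinAt ?_
    have h1 : (z - a) ^ (p + 1) ≠ 0 := pow_ne_zero _ (sub_ne_zero.mpr fun h => ha (h ▸ hz))
    have h2 : DifferentiableAt ℂ
        (fun z => ∑ k ∈ Finset.univ.erase i, ρ k / (z - ζ k)) z := by
      refine DifferentiableAt.fun_sum fun k hk => ?_
      have h3 : z - ζ k ≠ 0 :=
        sub_ne_zero.mpr fun h => hζ k (Finset.ne_of_mem_erase hk) (h ▸ hz)
      fun_prop (disch := assumption)
    fun_prop (disch := assumption)
  have hc := hgd.circleIntegral_sub_inv_smul (Metric.mem_ball_self hr)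
  have hcongr : (∮ z in C(ζ i, r),
      (∑ k, ρ k / (z - ζ k) + (b + v * z)) / (z - a) ^ (p + 1)) =
      ∮ z in C(ζ i, r), (z - ζ i)⁻¹ • g z := by
    refine circleIntegral.integral_congr hr.le fun z hz => ?_
    have h3 : z - ζ i ≠ 0 := sub_ne_zero.mpr (Metric.ne_of_mem_sphere hz hr.ne')
    simp only [hg, smul_eq_mul]
    rw [← Finset.add_sum_erase _ _ (Finset.mem_univ i)]
    field_simp
    ring
  rw [circleResidue, hcongr, hc, smul_eq_mul, ← mul_assoc, inv_mul_cancel₀ Complex.two_pi_I_ne_zero,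
    one_mul]
  simp [hg]

lemma _root_.circleIntegral_inv_sub_pow {a : ℂ} {R : ℝ} (ha : ‖a‖ < R) (p : ℕ) :
    (∮ z in C(0, R), 1 / (z - a) ^ (p + 1)) =
      if p = 0 then 2 * (Real.pi : ℂ) * Complex.I else 0 := by
  rcases p with _ | p
  · simpa using circleIntegral.integral_sub_inv_of_mem_ball (c := 0) (w := a) (R := R) (by simpa)
  · have h := circleIntegral.integral_sub_zpow_of_ne (n := -((p + 1 + 1 : ℕ) : ℤ))
      (by push_cast; omega) 0 a R
    simp only [zpow_neg, zpow_natCast] at h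
    simpa [one_div] using h

lemma _root_.continuousOn_inv_sub_pow {a : ℂ} {R : ℝ} (ha : ‖a‖ < R) (p : ℕ) :
    ContinuousOn (fun z : ℂ => 1 / (z - a) ^ p) (Metric.sphere 0 R) := by
  refine continuousOn_const.div (by fun_prop) fun z hz => pow_ne_zero _ (sub_ne_zero.mpr ?_)
  rintro rfl
  simp only [mem_sphere_iff_norm, sub_zero] at hz
  exact ha.ne hz

/-- The integrand decays at least like z⁻² and all its poles are enclosed. The proof splits off
partial fractions to lower the power: for `p = 0` the two residues cancel, and afterwards both terms
of `key` vanish. -/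
lemma _root_.circleIntegral_inv_sub_mul_inv_sub_pow {a ζ : ℂ} {R : ℝ} (ha : ‖a‖ < R)
    (hζ : ‖ζ‖ < R) (hne : ζ ≠ a) (p : ℕ) :
    (∮ z in C(0, R), 1 / (z - ζ) ^ 1 * (1 / (z - a) ^ (p + 1))) = 0 := by
  have hR : 0 ≤ R := (norm_nonneg a).trans ha.le
  have hza : ζ - a ≠ 0 := sub_ne_zero.mpr hne
  have key : ∀ q : ℕ, (∮ z in C(0, R), 1 / (z - ζ) ^ 1 * (1 / (z - a) ^ (q + 1))) =
      (ζ - a)⁻¹ * ((∮ z in C(0, R), 1 / (z - ζ) ^ 1 * (1 / (z - a) ^ q)) -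
        ∮ z in C(0, R), 1 / (z - a) ^ (q + 1)) := by
    intro q
    have hc : ContinuousOn (fun z => 1 / (z - ζ) ^ 1 * (1 / (z - a) ^ q)) (Metric.sphere 0 R) :=
      (continuousOn_inv_sub_pow hζ 1).mul (continuousOn_inv_sub_pow ha q)
    rw [← circleIntegral.integral_sub (hc.circleIntegrable hR)
      ((continuousOn_inv_sub_pow ha (q + 1)).circleIntegrable hR),
      ← circleIntegral.integral_const_mul]
    refine circleIntegral.integral_congr hR fun z hz => ?_
    simp only [mem_sphere_iff_norm, sub_zero] at hz
    have h1 : z - ζ ≠ 0 := sub_ne_zero.mpr (by rintro rfl; exact hζ.ne hz)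
    have h2 : z - a ≠ 0 := sub_ne_zero.mpr (by rintro rfl; exact ha.ne hz)
    field_simp
    ring
  induction p with
  | zero =>
    rw [key 0, circleIntegral_inv_sub_pow ha]
    have := circleIntegral_inv_sub_pow hζ 0
    simp only [zero_add, if_true] at this
    simp only [pow_zero, div_one, mul_one, this, if_true, sub_self, mul_zero]
  | succ p ih => rw [key, ih, circleIntegral_inv_sub_pow ha]; simp

/-- The Taylor coefficients at `a` of the affine function `z ↦ b + z v`. -/
def _root_.affineCoeff {V : Type*} [AddCommGroup V] [Module ℂ V] (a : ℂ) (b v : V) (p : ℕ) : V :=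
  if p = 0 then b + a • v else if p = 1 then v else 0

/-- The pole terms integrate to zero over a circle enclosing everything. Re-expanding `b + v * z =
(b + a * v) + v * (z - a)` leaves one integral of `1 / (z - a)` when `p ≤ 1` and none for larger
`p`. -/
lemma _root_.circleResidue_infinity_kernel {n : ℕ} {ζ ρ : Fin n → ℂ} {a b v : ℂ} {R : ℝ} (p : ℕ)
    (ha : ‖a‖ < R) (hζ : ∀ k, ‖ζ k‖ < R) (hne : ∀ k, ζ k ≠ a) :
    circleResidue 0 R (fun z => (∑ k, ρ k / (z - ζ k) + (b + v * z)) / (z - a) ^ (p + 1)) =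
      affineCoeff a b v p := by
  have hR : 0 ≤ R := (norm_nonneg a).trans ha.le
  have hcongr : (∮ z in C(0, R),
      (∑ k, ρ k / (z - ζ k) + (b + v * z)) / (z - a) ^ (p + 1)) =
      ∮ z in C(0, R), (∑ k, ρ k * (1 / (z - ζ k) ^ 1 * (1 / (z - a) ^ (p + 1)))) +
        ((b + a * v) * (1 / (z - a) ^ (p + 1)) + v * (1 / (z - a) ^ p)) := by
    refine circleIntegral.integral_congr hR fun z hz => ?_
    simp only [mem_sphere_iff_norm, sub_zero] at hz
    have h2 : z - a ≠ 0 := sub_ne_zero.mpr (by rintro rfl; exact ha.ne hz)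
    rw [add_div, Finset.sum_div]
    congr 1
    · refine Finset.sum_congr rfl fun k _ => ?_
      rw [div_div, pow_one, div_eq_mul_one_div, one_div_mul_one_div]
    · field_simp
      ring
  have c1 : ∀ k, ContinuousOn (fun z => ρ k * (1 / (z - ζ k) ^ 1 * (1 / (z - a) ^ (p + 1))))
      (Metric.sphere 0 R) := fun k => continuousOn_const.mul
    ((continuousOn_inv_sub_pow (hζ k) 1).mul (continuousOn_inv_sub_pow ha _))
  have c2 : ContinuousOn (fun z => (b + a * v) * (1 / (z - a) ^ (p + 1))) (Metric.sphere 0 R) :=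
    continuousOn_const.mul (continuousOn_inv_sub_pow ha _)
  have c3 : ContinuousOn (fun z => v * (1 / (z - a) ^ p)) (Metric.sphere 0 R) :=
    continuousOn_const.mul (continuousOn_inv_sub_pow ha _)
  have c4 : ContinuousOn (fun z => (b + a * v) * (1 / (z - a) ^ (p + 1)) +
      v * (1 / (z - a) ^ p)) (Metric.sphere 0 R) := c2.add c3
  rw [circleResidue, hcongr, circleIntegral.integral_add
    ((continuousOn_finsetSum _ fun k _ => c1 k).circleIntegrable hR) (c4.circleIntegrable hR), circleIntegral.integral_add (c2.circleIntegrable hR)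
    (c3.circleIntegrable hR), circleIntegral.integral_fun_sum fun k _ => (c1 k).circleIntegrable hR]
  simp_rw [circleIntegral.integral_const_mul]
  rw [Finset.sum_eq_zero fun k _ => by
    rw [circleIntegral_inv_sub_mul_inv_sub_pow ha (hζ k) (hne k), mul_zero],
    circleIntegral_inv_sub_pow ha, affineCoeff]
  have hpi := Complex.two_pi_I_ne_zero
  rcases p with _ | _ | p
  · have h0 : (∮ z in C(0, R), 1 / (z - a) ^ 0) = 0 := by
      simpa using circleIntegral.integral_sub_zpow_of_ne (n := 0) (by norm_num) 0 a R
    rw [h0]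
    simp only [if_true, smul_eq_mul]
    field_simp
    ring
  · rw [circleIntegral_inv_sub_pow ha]
    simp only [zero_add, if_true, one_ne_zero, if_false]
    field_simp
    ring
  · rw [circleIntegral_inv_sub_pow ha]
    simp

/-! ### Functional derivatives of the Hamiltonians -/

section Gradient

variable {𝔤 : Type*} [LieRing 𝔤] [LieAlgebra ℂ 𝔤]

lemma _root_.kappa_add_left (X Y Z : 𝔤) : kappa (X + Y) Z = kappa X Z + kappa Y Z := by
  simp [kappa]; ring

lemma _root_.kappa_smul_left (c : ℂ) (X Z : 𝔤) : kappa (c • X) Z = c * kappa X Z := by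
  simp [kappa]

lemma _root_.kappa_comm (X Y : 𝔤) : kappa X Y = kappa Y X := by
  rw [kappa, kappa, LieModule.traceForm_comm]

lemma _root_.kappa_add_right (X Y Z : 𝔤) : kappa X (Y + Z) = kappa X Y + kappa X Z := by
  simp [kappa]; ring

lemma _root_.kappa_smul_right (c : ℂ) (X Z : 𝔤) : kappa X (c • Z) = c * kappa X Z := by
  simp [kappa]

/-- Contraction with `κ` on the right, as a linear form. -/
def _root_.kappaDual (X : 𝔤) : Module.Dual ℂ 𝔤 where
  toFun Y := kappa Y X
  map_add' Y Z := kappa_add_left Y Z X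
  map_smul' c Y := kappa_smul_left c Y X

lemma _root_.eq_of_forall_kappa [FiniteDimensional ℂ 𝔤] [LieAlgebra.IsSemisimple ℂ 𝔤] {v w : 𝔤}
    (h : ∀ X, kappa v X = kappa w X) : v = w := by
  have hk : (killingForm ℂ 𝔤).Nondegenerate := LieAlgebra.IsKilling.killingForm_nondegenerate ℂ 𝔤
  rw [← sub_eq_zero]
  refine hk.1 _ fun X => ?_
  have := h X
  simp only [kappa, neg_inj] at this
  rw [map_sub, LinearMap.sub_apply, this, sub_self]

lemma differentiableAt_polarSum (j : S → ℕ → ℂ) {z : ℂ} (hz : z ∉ Set.range D.pos) :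
    DifferentiableAt ℂ (D.polarSum j) z := by
  unfold polarSum
  refine DifferentiableAt.fun_sum fun α _ => DifferentiableAt.fun_sum fun p _ => ?_
  have h := pow_ne_zero (p + 1) (D.sub_pos_ne_zero hz α)
  fun_prop (disch := assumption)

lemma differentiableAt_kappa_gaudinLax (J : S → ℕ → 𝔤) (X : 𝔤) {z : ℂ}
    (hz : z ∉ Set.range D.pos) :
    DifferentiableAt ℂ (fun z => kappa (D.gaudinLax J z) X) z := by
  have h : (fun z => kappa (D.gaudinLax J z) X) = D.polarSum fun α p => kappa (J α p) X :=
    funext fun z => D.dual_gaudinLax (kappaDual X) J z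
  rw [h]
  exact D.differentiableAt_polarSum _ hz

lemma differentiableAt_kappa_gaudinLax_self (J : S → ℕ → 𝔤) {z : ℂ}
    (hz : z ∉ Set.range D.pos) :
    DifferentiableAt ℂ (fun z => kappa (D.gaudinLax J z) (D.gaudinLax J z)) z := by
  have h : (fun z => kappa (D.gaudinLax J z) (D.gaudinLax J z)) = fun z =>
      ∑ α, ∑ p ∈ Finset.range (D.m α),
        kappa (D.gaudinLax J z) (J α p) / (z - D.pos α) ^ (p + 1) := by
    funext z
    refine (D.dual_gaudinLax (kappaDual (D.gaudinLax J z)) J z).trans ?_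
    simp only [polarSum]
    refine Finset.sum_congr rfl fun α _ => Finset.sum_congr rfl fun p _ => ?_
    rw [kappa_comm]
    rfl
  rw [h]
  refine DifferentiableAt.fun_sum fun α _ => DifferentiableAt.fun_sum fun p _ => ?_
  have h := pow_ne_zero (p + 1) (D.sub_pos_ne_zero hz α)
  have h2 := D.differentiableAt_kappa_gaudinLax J (J α p) hz
  fun_prop (disch := assumption)

lemma differentiableAt_twist {z : ℂ} (hz : z ∉ Set.range D.pos) :
    DifferentiableAt ℂ D.twist z :=
  D.differentiableAt_polarSum D.level hz

/-- The coefficient of `1 / (z - ζ)` in the contribution of the zero `ζ` to the Lax matrix. -/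
def zeroResidue (J : S → ℕ → 𝔤) (ζ : ℂ) : 𝔤 := (1 / deriv D.twist ζ) • D.gaudinLax J ζ

lemma zeroTerm_eq (J : S → ℕ → 𝔤) (ζ z : ℂ) :
    D.zeroTerm J ζ z = (1 / (z - ζ)) • D.zeroResidue J ζ := by
  rw [zeroTerm, zeroResidue, smul_smul, mul_comm]

section Zeroes

variable {D} {n : ℕ} {ζ : Fin n → ℂ}

lemma HasSimpleZeroes.differentiableAt_chargeDensity (h : D.HasSimpleZeroes ζ) (J : S → ℕ → 𝔤)
    {z : ℂ} (hz : z ∉ Set.range D.pos ∪ Set.range ζ) :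
    DifferentiableAt ℂ (D.chargeDensity J) z := by
  rw [Set.mem_union, not_or] at hz
  have h1 := D.differentiableAt_kappa_gaudinLax_self J hz.1
  have h2 := D.differentiableAt_twist hz.1
  have h3 : 2 * D.twist z ≠ 0 := mul_ne_zero two_ne_zero (h.twist_ne_zero hz.1 hz.2)
  unfold chargeDensity
  fun_prop (disch := assumption)

lemma kappa_laxL_eq {J : S → ℕ → 𝔤} {A V : 𝔤} {z : ℂ}
    (hL : D.laxL J z = ∑ i, D.zeroTerm J (ζ i) z + (A + z • V)) (X : 𝔤) :
    kappa (D.laxL J z) X =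
      ∑ i, kappa (D.zeroResidue J (ζ i)) X / (z - ζ i) + (kappa A X + kappa V X * z) := by
  have := congrArg (kappaDual X) hL
  simp only [map_add, map_sum, map_smul, zeroTerm_eq, smul_eq_mul] at this
  refine this.trans ?_
  congr 1
  · refine Finset.sum_congr rfl fun i _ => ?_
    rw [one_div_mul_eq_div]
    rfl
  · rw [mul_comm z]
    rfl

lemma kappa_affineCoeff (a : ℂ) (A V X : 𝔤) (p : ℕ) :
    kappa (affineCoeff a A V p) X = affineCoeff a (kappa A X) (kappa V X) p := by
  unfold affineCoeff
  split_ifs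
  · rw [kappa_add_left, kappa_smul_left, smul_eq_mul]
  · rfl
  · simp [kappa]

end Zeroes

variable [DecidableEq S]

lemma gaudinLax_update (J : S → ℕ → 𝔤) {α : S} {p : ℕ} (hp : p < D.m α) (s : ℂ) (X : 𝔤) (z : ℂ) :
    D.gaudinLax (Function.update J α (Function.update (J α) p (J α p + s • X))) z =
      D.gaudinLax J z + (s * (1 / (z - D.pos α) ^ (p + 1))) • X := by
  rw [← sub_eq_iff_eq_add', gaudinLax, gaudinLax, ← Finset.sum_sub_distrib,
    Finset.sum_eq_single α, ← Finset.sum_sub_distrib, Finset.sum_eq_single p]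
  · rw [Function.update_self, Function.update_self, smul_add, add_sub_cancel_left, smul_smul,
      mul_comm]
  · intro q _ hq
    rw [Function.update_self, Function.update_of_ne hq, sub_self]
  · intro h; exact absurd (Finset.mem_range.mpr hp) h
  · intro β _ hβ
    rw [Function.update_of_ne hβ, sub_self]
  · simp

lemma constraint_update (J : S → ℕ → 𝔤) (α : S) (p : ℕ) (s : ℂ) (X : 𝔤) :
    D.constraint (Function.update J α (Function.update (J α) p (J α p + s • X))) =
      D.constraint J + (if p = 0 then s else 0) • X := by
  rw [← sub_eq_iff_eq_add', constraint, constraint, ← Finset.sum_sub_distrib,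
    Finset.sum_eq_single α]
  · rw [Function.update_self]
    split_ifs with h
    · subst h; simp
    · rw [Function.update_of_ne (Ne.symm h)]; simp
  · intro β _ hβ
    rw [Function.update_of_ne hβ, sub_self]
  · simp

/-- The Lax matrix is affine in `s` and the density is quadratic in the Lax matrix. The coefficient
of `s` pairs the direction `X` with 𝓛, because Γ/φ = 𝓛. -/
lemma chargeDensity_update (J : S → ℕ → 𝔤) {α : S} {p : ℕ} (hp : p < D.m α) (s : ℂ) (X : 𝔤)
    (z : ℂ) :
    D.chargeDensity (Function.update J α (Function.update (J α) p (J α p + s • X))) z =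
      D.chargeDensity J z +
        s * (-(kappa (D.laxL J z) X / (z - D.pos α) ^ (p + 1))) +
        s ^ 2 * (-kappa X X * (1 / (z - D.pos α) ^ (p + 1)) ^ 2 / (2 * D.twist z)) := by
  rw [chargeDensity, chargeDensity, D.gaudinLax_update J hp, laxL]
  simp only [kappa_add_left, kappa_add_right, kappa_smul_left, kappa_smul_right]
  rw [kappa_comm X (D.gaudinLax J z)]
  ring

section Zeroes

variable {D} {n : ℕ} {ζ : Fin n → ℂ}

/-- The derivative of a contour integral of the charge density. -/
lemma HasSimpleZeroes.hasDerivAt_circleResidue_chargeDensity (h : D.HasSimpleZeroes ζ)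
    (J : S → ℕ → 𝔤) {α : S} {p : ℕ} (hp : p < D.m α) (X : 𝔤) {c : ℂ} {r : ℝ} (hr : 0 ≤ r)
    (hsph : ∀ z ∈ Metric.sphere c r, z ∉ Set.range D.pos ∪ Set.range ζ) :
    HasDerivAt (fun s : ℂ => circleResidue c r (D.chargeDensity
        (Function.update J α (Function.update (J α) p (J α p + s • X)))))
      (-circleResidue c r fun z => kappa (D.laxL J z) X / (z - D.pos α) ^ (p + 1)) 0 := by
  have hsph' := hsph
  simp only [Set.mem_union, not_or] at hsph'
  have key := hasDerivAt_circleResidue hr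
    (F := fun s => D.chargeDensity
        (Function.update J α (Function.update (J α) p (J α p + s • X))))
    (F₀ := D.chargeDensity J)
    (F₁ := fun z => -(kappa (D.laxL J z) X / (z - D.pos α) ^ (p + 1)))
    (F₂ := fun z => -kappa X X * (1 / (z - D.pos α) ^ (p + 1)) ^ 2 / (2 * D.twist z))
    (fun z hz => (h.differentiableAt_chargeDensity J (hsph z hz)).continuousAt.continuousWithinAt)
    (fun z hz => ?_) (fun z hz => ?_) (fun s z _ => D.chargeDensity_update J hp s X z)
  · convert key using 1
    simp only [circleResidue]
    have : (∮ z in C(c, r), -(kappa (D.laxL J z) X / (z - D.pos α) ^ (p + 1))) =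
        (-1) * ∮ z in C(c, r), kappa (D.laxL J z) X / (z - D.pos α) ^ (p + 1) := by
      rw [← circleIntegral.integral_const_mul]
      simp
    rw [this]
    ring
  · refine DifferentiableAt.continuousAt (𝕜 := ℂ) ?_ |>.continuousWithinAt
    have h1 := D.differentiableAt_kappa_gaudinLax J X (hsph' z hz).1
    have h2 := D.differentiableAt_twist (hsph' z hz).1
    have h3 := h.twist_ne_zero (hsph' z hz).1 (hsph' z hz).2
    have h4 := pow_ne_zero (p + 1) (D.sub_pos_ne_zero (hsph' z hz).1 α)
    simp only [laxL, kappa_smul_left]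
    fun_prop (disch := assumption)
  · refine DifferentiableAt.continuousAt (𝕜 := ℂ) ?_ |>.continuousWithinAt
    have h2 := D.differentiableAt_twist (hsph' z hz).1
    have h3 : 2 * D.twist z ≠ 0 :=
      mul_ne_zero two_ne_zero (h.twist_ne_zero (hsph' z hz).1 (hsph' z hz).2)
    have h4 := pow_ne_zero (p + 1) (D.sub_pos_ne_zero (hsph' z hz).1 α)
    fun_prop (disch := assumption)

/-- On a circle isolating `ζ i` from the sites and the other zeroes, only the pole of 𝓛 at `ζ i`
contributes; the affine part is regular there and drops out. -/
lemma HasSimpleZeroes.hasDerivAt_residueAt (h : D.HasSimpleZeroes ζ) {J : S → ℕ → 𝔤} {A V : 𝔤}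
    (hL : ∀ z, z ∉ Set.range D.pos → z ∉ Set.range ζ →
      D.laxL J z = ∑ i, D.zeroTerm J (ζ i) z + (A + z • V))
    {α : S} {p : ℕ} (hp : p < D.m α) (X : 𝔤) (i : Fin n) :
    HasDerivAt (fun s : ℂ => residueAt (D.chargeDensity
        (Function.update J α (Function.update (J α) p (J α p + s • X)))) (ζ i))
      (-(kappa (D.zeroResidue J (ζ i)) X / (ζ i - D.pos α) ^ (p + 1))) 0 := by
  obtain ⟨r, hr, hiso⟩ := exists_isolating_radius
    ((Set.finite_range D.pos).union (Set.finite_range ζ)) (ζ i)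
  have hsph : ∀ z ∈ Metric.sphere (ζ i) r, z ∉ Set.range D.pos ∪ Set.range ζ := fun z hz =>
    hiso z (Metric.sphere_subset_closedBall hz) (Metric.ne_of_mem_sphere hz hr.ne')
  have heq : ∀ K : S → ℕ → 𝔤, residueAt (D.chargeDensity K) (ζ i) =
      circleResidue (ζ i) r (D.chargeDensity K) := fun K =>
    residueAt_eq_circleResidue hr fun z hz hne =>
      h.differentiableAt_chargeDensity K (hiso z hz hne)
  simp only [heq]
  have hd := h.hasDerivAt_circleResidue_chargeDensity J hp X hr.le hsph
  have hα : D.pos α ∉ Metric.closedBall (ζ i) r := fun hmem =>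
    hiso _ hmem (fun he => h.notMem_range_pos i ⟨α, he⟩) (Or.inl ⟨α, rfl⟩)
  have hk : ∀ k ≠ i, ζ k ∉ Metric.closedBall (ζ i) r := fun k hki hmem =>
    hiso _ hmem (h.1.ne hki) (Or.inr ⟨k, rfl⟩)
  have hval := circleResidue_zero_kernel (ρ := fun k => kappa (D.zeroResidue J (ζ k)) X)
    (b := kappa A X) (v := kappa V X) hr p hα hk
  refine hd.congr_deriv (congrArg Neg.neg ?_)
  rw [← hval, circleResidue, circleResidue]
  congr 1
  refine circleIntegral.integral_congr hr.le fun z hz => ?_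
  have hz' := hsph z hz
  rw [Set.mem_union, not_or] at hz'
  rw [kappa_laxL_eq (hL z hz'.1 hz'.2)]

/-- On a circle enclosing all sites and zeroes only the affine part of 𝓛 contributes. The sign in
the residue at infinity cancels the one in the charge density. -/
lemma HasSimpleZeroes.hasDerivAt_residueInfinity (h : D.HasSimpleZeroes ζ) {J : S → ℕ → 𝔤}
    {A V : 𝔤} (hL : ∀ z, z ∉ Set.range D.pos → z ∉ Set.range ζ →
      D.laxL J z = ∑ i, D.zeroTerm J (ζ i) z + (A + z • V))
    {α : S} {p : ℕ} (hp : p < D.m α) (X : 𝔤) :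
    HasDerivAt (fun s : ℂ => residueInfinity (D.chargeDensity
        (Function.update J α (Function.update (J α) p (J α p + s • X)))))
      (kappa (affineCoeff (D.pos α) A V p) X) 0 := by
  obtain ⟨R, hR, hbig⟩ := exists_enclosing_radius
    ((Set.finite_range D.pos).union (Set.finite_range ζ))
  have hsph : ∀ z ∈ Metric.sphere 0 R, z ∉ Set.range D.pos ∪ Set.range ζ := fun z hz hmem =>
    (hbig z hmem).ne (by simpa using hz)
  have heq : ∀ K : S → ℕ → 𝔤, residueInfinity (D.chargeDensity K) =
      -circleResidue 0 R (D.chargeDensity K) := fun K =>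
    residueInfinity_eq_circleResidue hR fun z hz =>
      h.differentiableAt_chargeDensity K fun hmem => (hbig z hmem).not_ge hz
  simp only [heq]
  have hd := (h.hasDerivAt_circleResidue_chargeDensity J hp X hR.le hsph).fun_neg
  have hval := circleResidue_infinity_kernel (ρ := fun k => kappa (D.zeroResidue J (ζ k)) X)
    (b := kappa A X) (v := kappa V X) p (hbig _ (Or.inl ⟨α, rfl⟩))
    (fun k => hbig (ζ k) (Or.inr ⟨k, rfl⟩)) (fun k he => h.notMem_range_pos k ⟨α, he.symm⟩)
  refine hd.congr_deriv ?_
  rw [neg_neg, kappa_affineCoeff, ← hval, circleResidue, circleResidue]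
  congr 1
  refine circleIntegral.integral_congr hR.le fun z hz => ?_
  have hz' := hsph z hz
  rw [Set.mem_union, not_or] at hz'
  rw [kappa_laxL_eq (hL z hz'.1 hz'.2)]

/-- The Taylor coefficients at the sites of `∑ ε_i R_i / (z - ζ_i) + U + z V`. -/
def taylorGradient (D : GaudinDatum S) (ζ ε : Fin n → ℂ) (R : Fin n → 𝔤) (U V : 𝔤)
    (α : S) (p : ℕ) : 𝔤 :=
  ∑ i, ε i • (-(1 / (ζ i - D.pos α) ^ (p + 1))) • R i + affineCoeff (D.pos α) U V p

lemma hasDerivAt_kappa_constraint (J : S → ℕ → 𝔤) (μ : 𝔤) (α : S) (p : ℕ) (X : 𝔤) :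
    HasDerivAt (fun s : ℂ => kappa μ (D.constraint
      (Function.update J α (Function.update (J α) p (J α p + s • X)))))
      (kappa (affineCoeff (D.pos α) μ 0 p) X) 0 := by
  simp only [constraint_update, kappa_add_right, kappa_smul_right]
  by_cases hp : p = 0
  · simpa [hp, affineCoeff] using
      ((hasDerivAt_id' (0 : ℂ)).mul_const (kappa μ X)).const_add (kappa μ (D.constraint J))
  · have : affineCoeff (D.pos α) μ 0 p = 0 := by simp [affineCoeff, hp]
    rw [this]
    simpa [hp, kappa] using hasDerivAt_const (0 : ℂ) (-(killingForm ℂ 𝔤 μ) (D.constraint J))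

variable [FiniteDimensional ℂ 𝔤] [LieAlgebra.IsSemisimple ℂ 𝔤]

/-- Derivatives are unique and κ is nondegenerate, so the gradient can be identified by pairing with
every `X`. -/
lemma HasSimpleZeroes.gradient_hamiltonianI (h : D.HasSimpleZeroes ζ) (ε : Fin n → ℂ)
    {J f : S → ℕ → 𝔤} {A V μ : 𝔤} (hL : ∀ z, z ∉ Set.range D.pos → z ∉ Set.range ζ →
      D.laxL J z = ∑ i, D.zeroTerm J (ζ i) z + (A + z • V))
    (hf : D.IsGradient (fun K => D.hamiltonianI ζ ε K μ) J f) {α : S} {p : ℕ} (hp : p < D.m α) :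
    f α p = D.taylorGradient ζ ε (fun i => D.zeroResidue J (ζ i)) μ 0 α p := by
  refine eq_of_forall_kappa fun X => (hf α p hp X).unique ?_
  have h1 := (HasDerivAt.fun_sum fun i (_ : i ∈ Finset.univ) =>
    (h.hasDerivAt_residueAt hL hp X i).const_mul (ε i)).fun_add
      (hasDerivAt_kappa_constraint (D := D) J μ α p X)
  refine h1.congr_deriv ?_
  change _ = kappaDual X _
  simp only [taylorGradient, map_add, map_sum, map_smul, smul_eq_mul]
  congr 1
  refine Finset.sum_congr rfl fun i _ => ?_
  change _ = ε i * (_ * kappa _ X)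
  ring

lemma HasSimpleZeroes.gradient_hamiltonianII (h : D.HasSimpleZeroes ζ) (ε : Fin (n + 1) → ℂ)
    {J f : S → ℕ → 𝔤} {A V μ : 𝔤} (hL : ∀ z, z ∉ Set.range D.pos → z ∉ Set.range ζ →
      D.laxL J z = ∑ i, D.zeroTerm J (ζ i) z + (A + z • V))
    (hf : D.IsGradient (fun K => D.hamiltonianII ζ ε K μ) J f) {α : S} {p : ℕ} (hp : p < D.m α) :
    f α p = D.taylorGradient ζ (fun i => ε i.castSucc) (fun i => D.zeroResidue J (ζ i))
      (ε (Fin.last n) • A + μ) (ε (Fin.last n) • V) α p := by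
  refine eq_of_forall_kappa fun X => (hf α p hp X).unique ?_
  have h1 := ((HasDerivAt.fun_sum fun i (_ : i ∈ Finset.univ) =>
    (h.hasDerivAt_residueAt hL hp X i).const_mul (ε i.castSucc)).fun_add
      ((h.hasDerivAt_residueInfinity hL hp X).const_mul (ε (Fin.last n)))).fun_add
      (hasDerivAt_kappa_constraint (D := D) J μ α p X)
  refine h1.congr_deriv ?_
  have h2 : affineCoeff (D.pos α) (ε (Fin.last n) • A + μ) (ε (Fin.last n) • V) p =
      ε (Fin.last n) • affineCoeff (D.pos α) A V p + affineCoeff (D.pos α) μ 0 p := by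
    unfold affineCoeff
    split_ifs <;> module
  change _ = kappaDual X _
  simp only [taylorGradient, h2, map_add, map_sum, map_smul, smul_eq_mul]
  rw [← add_assoc]
  congr 2
  refine Finset.sum_congr rfl fun i _ => ?_
  change _ = ε i.castSucc * (_ * kappa _ X)
  ring

end Zeroes

end Gradient

/-! ### The Takiff flow generated by Taylor coefficients -/

section Flow

lemma _root_.Finset.sum_filter_add_lt {V : Type*} [AddCommMonoid V] (m : ℕ) (F : ℕ → ℕ → V) :
    ∑ q ∈ Finset.range m, ∑ p ∈ (Finset.range m).filter (fun p => p + q < m), F q p =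
      ∑ r ∈ Finset.range m, ∑ p ∈ Finset.range (r + 1), F (r - p) p := by
  rw [Finset.sum_sigma', Finset.sum_sigma']
  refine Finset.sum_bij' (fun x _ => ⟨x.2 + x.1, x.2⟩) (fun x _ => ⟨x.1 - x.2, x.2⟩) ?_ ?_ ?_ ?_ ?_
  · rintro ⟨q, p⟩ h
    simp only [Finset.mem_sigma, Finset.mem_range, Finset.mem_filter] at h ⊢
    omega
  · rintro ⟨r, p⟩ h
    simp only [Finset.mem_sigma, Finset.mem_range, Finset.mem_filter] at h ⊢
    omega
  · rintro ⟨q, p⟩ h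
    simp
  · rintro ⟨r, p⟩ h
    simp only [Finset.mem_sigma, Finset.mem_range] at h
    simp only [Sigma.mk.injEq, heq_eq_eq, and_true]
    omega
  · rintro ⟨q, p⟩ h
    simp

/-- A finite geometric sum. It is used with `w = z - a` and `v = ζ - a`, so that `-(1 / v ^ (p +
1))` are the Taylor coefficients of `1 / (z - ζ)` at `a`. -/
lemma _root_.sum_inv_pow_mul_inv_pow {w v : ℂ} (hw : w ≠ 0) (hv : v ≠ 0) (hne : w - v ≠ 0)
    (r : ℕ) :
    ∑ p ∈ Finset.range (r + 1), 1 / w ^ (r - p + 1) * -(1 / v ^ (p + 1)) =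
      (1 / w ^ (r + 1) - 1 / v ^ (r + 1)) * (1 / (w - v)) := by
  induction r with
  | zero => simp; field_simp; ring
  | succ r ih =>
    rw [Finset.sum_range_succ]
    have h1 : ∑ p ∈ Finset.range (r + 1), 1 / w ^ (r + 1 - p + 1) * -(1 / v ^ (p + 1)) =
        1 / w * ∑ p ∈ Finset.range (r + 1), 1 / w ^ (r - p + 1) * -(1 / v ^ (p + 1)) := by
      rw [Finset.mul_sum]
      refine Finset.sum_congr rfl fun p hp => ?_
      have h2 : r + 1 - p + 1 = (r - p + 1) + 1 := by
        have := Finset.mem_range.mp hp; omega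
      rw [h2, pow_succ w (r - p + 1)]
      field_simp
    rw [h1, ih]
    simp only [Nat.sub_self, zero_add, pow_one]
    field_simp
    ring

section Module

variable {V : Type*} [AddCommGroup V] [Module ℂ V]

/-- An affine function has only two Taylor coefficients, so truncation at order `r` loses something
only for `r = 0`, namely the linear term `(z - a) • W` divided by `z - a`. -/
lemma _root_.sum_smul_affineCoeff {a z : ℂ} (hz : z - a ≠ 0) (A W : V) (r : ℕ) :
    ∑ p ∈ Finset.range (r + 1), (1 / (z - a) ^ (r - p + 1)) • affineCoeff a A W p =
      (1 / (z - a) ^ (r + 1)) • (A + z • W) - if r = 0 then W else 0 := by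
  rcases r with _ | r
  · have h : W = (1 / (z - a)) • (z - a) • W := by
      rw [smul_smul, one_div_mul_cancel hz, one_smul]
    simp only [zero_add, Finset.sum_range_one, Nat.sub_zero, pow_one, affineCoeff, if_true]
    nth_rw 3 [h]
    module
  · rw [Finset.sum_range_succ', Finset.sum_range_succ', Finset.sum_eq_zero]
    · have h : (1 / (z - a) ^ (r + 1)) • W = (1 / (z - a) ^ (r + 2)) • (z - a) • W := by
        rw [smul_smul, pow_succ _ (r + 1)]
        congr 1
        field_simp
      simp only [affineCoeff, zero_add, Nat.sub_zero, Nat.add_sub_cancel, one_ne_zero, if_true,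
        if_false, Nat.succ_ne_zero, sub_zero]
      rw [h]
      module
    · intro p _
      simp [affineCoeff]

/-- The rational function `∑ ε_i R_i / (z - ζ_i) + U + z W`. -/
def _root_.simplePolesPlusAffine {n : ℕ} (ζ ε : Fin n → ℂ) (R : Fin n → V) (U W : V) (z : ℂ) : V :=
  ∑ i, ε i • (1 / (z - ζ i)) • R i + (U + z • W)

end Module

variable {n : ℕ} {𝔤 : Type*} [LieRing 𝔤] [LieAlgebra ℂ 𝔤]

/-- The left side is the principal part at the site of N(z)/(z - z_α)^(r+1), where N is
`simplePolesPlusAffine`. It is the whole function minus its poles at the `ζ i` and minus its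
constant term at infinity, which is present only for `r = 0`. -/
lemma sum_smul_taylorGradient {ζ : Fin n → ℂ} (ε : Fin n → ℂ) (R : Fin n → 𝔤) (U W : 𝔤) {α : S}
    {z : ℂ} (hz : z - D.pos α ≠ 0) (hζ : ∀ i, ζ i - D.pos α ≠ 0) (hzζ : ∀ i, z - ζ i ≠ 0) (r : ℕ) :
    ∑ p ∈ Finset.range (r + 1),
        (1 / (z - D.pos α) ^ (r - p + 1)) • D.taylorGradient ζ ε R U W α p =
      (1 / (z - D.pos α) ^ (r + 1)) • simplePolesPlusAffine ζ ε R U W z -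
        ∑ i, (1 / (ζ i - D.pos α) ^ (r + 1)) • ε i • (1 / (z - ζ i)) • R i -
        if r = 0 then W else 0 := by
  simp only [taylorGradient]
  rw [simplePolesPlusAffine, Finset.sum_congr rfl fun p _ => smul_add _ _ _,
    Finset.sum_add_distrib, sum_smul_affineCoeff hz]
  have h : ∑ p ∈ Finset.range (r + 1), (1 / (z - D.pos α) ^ (r - p + 1)) •
        ∑ i, ε i • (-(1 / (ζ i - D.pos α) ^ (p + 1))) • R i =
      (1 / (z - D.pos α) ^ (r + 1)) • ∑ i, ε i • (1 / (z - ζ i)) • R i -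
        ∑ i, (1 / (ζ i - D.pos α) ^ (r + 1)) • ε i • (1 / (z - ζ i)) • R i := by
    simp only [Finset.smul_sum]
    rw [Finset.sum_comm, ← Finset.sum_sub_distrib]
    refine Finset.sum_congr rfl fun i _ => ?_
    have hs : z - D.pos α - (ζ i - D.pos α) = z - ζ i := by ring
    have hg := sum_inv_pow_mul_inv_pow hz (hζ i) (by rw [hs]; exact hzζ i) r
    rw [hs] at hg
    have h2 := congrArg (fun c : ℂ => c • ε i • R i) hg
    simp only [Finset.sum_smul] at h2
    refine (Finset.sum_congr rfl fun p _ => ?_).trans (h2.trans ?_) <;> module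
  rw [h, smul_add _ _ (U + z • W)]
  abel

/-- Contracting coefficients `c α r` with truncated Taylor expansions at the sites. -/
lemma sum_contract {W : Type*} [AddCommGroup W] [Module ℂ W] (β : W →ₗ[ℂ] 𝔤 →ₗ[ℂ] 𝔤)
    (c : S → ℕ → W) {ζ : Fin n → ℂ} (ε : Fin n → ℂ) (R : Fin n → 𝔤) (U V : 𝔤) {z : ℂ}
    (hz : z ∉ Set.range D.pos) (hζ : ∀ i, ζ i ∉ Set.range D.pos) (hzζ : z ∉ Set.range ζ) :
    ∑ α, ∑ r ∈ Finset.range (D.m α), β (c α r) (∑ p ∈ Finset.range (r + 1),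
        (1 / (z - D.pos α) ^ (r - p + 1)) • D.taylorGradient ζ ε R U V α p) =
      β (∑ α, ∑ r ∈ Finset.range (D.m α), (1 / (z - D.pos α) ^ (r + 1)) • c α r)
          (simplePolesPlusAffine ζ ε R U V z) -
        ∑ i, β (∑ α, ∑ r ∈ Finset.range (D.m α), (1 / (ζ i - D.pos α) ^ (r + 1)) • c α r)
          (ε i • (1 / (z - ζ i)) • R i) - β (∑ α, c α 0) V := by
  have h0 : ∀ α, β (c α 0) V =
      ∑ r ∈ Finset.range (D.m α), β (c α r) (if r = 0 then V else 0) := by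
    intro α
    rw [Finset.sum_eq_single 0]
    · simp
    · intro b _ hb; simp [hb]
    · intro h; exact absurd (Finset.mem_range.mpr (D.m_pos α)) h
  have hzζ' : ∀ i, z - ζ i ≠ 0 := fun i h => hzζ ⟨i, (sub_eq_zero.mp h).symm⟩
  have h1 : ∑ i, β (∑ α, ∑ r ∈ Finset.range (D.m α), (1 / (ζ i - D.pos α) ^ (r + 1)) • c α r)
        (ε i • (1 / (z - ζ i)) • R i) =
      ∑ α, ∑ r ∈ Finset.range (D.m α), β (c α r)
        (∑ i, (1 / (ζ i - D.pos α) ^ (r + 1)) • ε i • (1 / (z - ζ i)) • R i) := by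
    simp only [map_sum, LinearMap.sum_apply]
    rw [Finset.sum_comm]
    refine Finset.sum_congr rfl fun α _ => ?_
    rw [Finset.sum_comm]
    refine Finset.sum_congr rfl fun r _ => Finset.sum_congr rfl fun i _ => ?_
    simp only [map_smul, LinearMap.smul_apply]
    module
  rw [h1]
  simp only [map_sum β, LinearMap.sum_apply, h0]
  rw [← Finset.sum_sub_distrib, ← Finset.sum_sub_distrib]
  refine Finset.sum_congr rfl fun α _ => ?_
  rw [← Finset.sum_sub_distrib, ← Finset.sum_sub_distrib]
  refine Finset.sum_congr rfl fun r _ => ?_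
  rw [D.sum_smul_taylorGradient ε R U V (D.sub_pos_ne_zero hz α)
    (fun i => D.sub_pos_ne_zero (hζ i) α) hzζ', map_sub, map_sub, map_smul (β (c α r)),
    map_smul β, LinearMap.smul_apply]

/-- Regrouping the Takiff bracket by the total mode `r = p + q` exposes the truncated Taylor sums to
which `sum_contract` applies. -/
lemma gaudinLax_takiffFlow (J f f' : S → ℕ → 𝔤) (z : ℂ) :
    D.gaudinLax (D.takiffFlow J f f') z =
      ∑ α, ∑ r ∈ Finset.range (D.m α),
        (⁅J α r, ∑ p ∈ Finset.range (r + 1), (1 / (z - D.pos α) ^ (r - p + 1)) • f α p⁆ +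
          D.level α r • ∑ p ∈ Finset.range (r + 1), (1 / (z - D.pos α) ^ (r - p + 1)) • f' α p) := by
  rw [gaudinLax]
  refine Finset.sum_congr rfl fun α _ => ?_
  simp only [takiffFlow, Finset.smul_sum]
  rw [Finset.sum_filter_add_lt (D.m α) fun q p => (1 / (z - D.pos α) ^ (q + 1)) •
    (⁅J α (p + q), f α p⁆ + D.level α (p + q) • f' α p)]
  refine Finset.sum_congr rfl fun r _ => ?_
  rw [lie_sum, ← Finset.sum_add_distrib]
  refine Finset.sum_congr rfl fun p hp => ?_
  have : p + (r - p) = r := by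
    have := Finset.mem_range.mp hp; omega
  rw [this, lie_smul, smul_add, smul_comm (D.level α r)]

/-- The flow of the Gaudin Lax matrix on the constraint surface. -/
lemma HasSimpleZeroes.gaudinLax_takiffFlow_eq {D : GaudinDatum S} {ζ : Fin n → ℂ}
    (h : D.HasSimpleZeroes ζ) {J f f' : S → ℕ → 𝔤} (hC : D.constraint J = 0)
    (ε : Fin n → ℂ) (U V : 𝔤) (R' : Fin n → 𝔤) (U' V' : 𝔤)
    (hf : ∀ α, ∀ p < D.m α,
      f α p = D.taylorGradient ζ ε (fun i => D.zeroResidue J (ζ i)) U V α p)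
    (hf' : ∀ α, ∀ p < D.m α, f' α p = D.taylorGradient ζ ε R' U' V' α p) {z : ℂ}
    (hz : z ∉ Set.range D.pos) (hz' : z ∉ Set.range ζ) :
    D.gaudinLax (D.takiffFlow J f f') z =
      ⁅D.gaudinLax J z,
          simplePolesPlusAffine ζ ε (fun i => D.zeroResidue J (ζ i)) U V z⁆ +
        D.twist z • simplePolesPlusAffine ζ ε R' U' V' z := by
  have hφ : ∀ y, ∑ α, ∑ r ∈ Finset.range (D.m α), (1 / (y - D.pos α) ^ (r + 1)) • D.level α r =
      D.twist y := by
    intro y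
    simp only [twist, smul_eq_mul, one_div_mul_eq_div]
  have h1 := D.sum_contract (LieModule.toEnd ℂ 𝔤 𝔤 : 𝔤 →ₗ[ℂ] 𝔤 →ₗ[ℂ] 𝔤) J ε
    (fun i => D.zeroResidue J (ζ i)) U V hz h.notMem_range_pos hz'
  have h2 := D.sum_contract (LinearMap.lsmul ℂ 𝔤 : ℂ →ₗ[ℂ] 𝔤 →ₗ[ℂ] 𝔤) D.level ε
    R' U' V' hz h.notMem_range_pos hz'
  simp only [hφ, h.twist_eq_zero, D.first_class, map_zero, LinearMap.zero_apply,
    Finset.sum_const_zero, sub_zero, LinearMap.lsmul_apply] at h2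
  -- The residue at `ζ i` is proportional to Γ(ζ_i), so the bracket has no pole there.
  have h3 : ∀ i, ⁅D.gaudinLax J (ζ i), ε i • (1 / (z - ζ i)) • D.zeroResidue J (ζ i)⁆ = 0 := by
    intro i
    rw [zeroResidue, lie_smul, lie_smul, lie_smul, lie_self]
    simp
  change _ = ⁅D.gaudinLax J z, _⁆ - ∑ i, ⁅D.gaudinLax J (ζ i), _⁆ - ⁅D.constraint J, V⁆ at h1
  rw [hC, zero_lie, Finset.sum_eq_zero fun i _ => h3 i, sub_zero, sub_zero] at h1
  rw [← h1, ← h2, ← Finset.sum_add_distrib, gaudinLax_takiffFlow]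
  refine Finset.sum_congr rfl fun α _ => ?_
  rw [← Finset.sum_add_distrib]
  refine Finset.sum_congr rfl fun r hr => ?_
  have hlt : ∀ p ∈ Finset.range (r + 1), p < D.m α := fun p hp => by
    have := Finset.mem_range.mp hp
    have := Finset.mem_range.mp hr
    omega
  rw [Finset.sum_congr rfl fun p hp => by rw [hf α p (hlt p hp)],
    Finset.sum_congr (f := fun p => (1 / (z - D.pos α) ^ (r - p + 1)) • f' α p) rfl
      fun p hp => by rw [hf' α p (hlt p hp)]]
  rfl

end Flow

/-! ### Derivatives of vector-valued fields -/

section FieldDerivative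

variable {V : Type*} [AddCommGroup V] [Module ℂ V]

lemma _root_.HasFieldDerivAt.unique {g : ℝ → V} {v w : V} {x : ℝ} (hv : HasFieldDerivAt g v x)
    (hw : HasFieldDerivAt g w x) : v = w := by
  rw [← sub_eq_zero, ← Module.forall_dual_apply_eq_zero_iff ℂ]
  intro l
  rw [map_sub, (hv l).unique (hw l), sub_self]

lemma _root_.HasFieldDerivAt.add {g k : ℝ → V} {v w : V} {x : ℝ} (hg : HasFieldDerivAt g v x)
    (hk : HasFieldDerivAt k w x) : HasFieldDerivAt (fun y => g y + k y) (v + w) x := by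
  intro l
  simpa only [map_add] using (hg l).fun_add (hk l)

lemma _root_.HasFieldDerivAt.sub {g k : ℝ → V} {v w : V} {x : ℝ} (hg : HasFieldDerivAt g v x)
    (hk : HasFieldDerivAt k w x) : HasFieldDerivAt (fun y => g y - k y) (v - w) x := by
  intro l
  simpa only [map_sub] using (hg l).fun_sub (hk l)

lemma _root_.HasFieldDerivAt.neg {g : ℝ → V} {v : V} {x : ℝ} (hg : HasFieldDerivAt g v x) :
    HasFieldDerivAt (fun y => -g y) (-v) x := by
  intro l
  simpa only [map_neg] using (hg l).fun_neg

lemma _root_.HasFieldDerivAt.const_smul {g : ℝ → V} {v : V} {x : ℝ} (c : ℂ)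
    (hg : HasFieldDerivAt g v x) : HasFieldDerivAt (fun y => c • g y) (c • v) x := by
  intro l
  simpa only [map_smul, smul_eq_mul] using (hg l).const_mul c

lemma _root_.HasFieldDerivAt.sum {ι : Type*} {s : Finset ι} {g : ι → ℝ → V} {v : ι → V} {x : ℝ}
    (hg : ∀ i ∈ s, HasFieldDerivAt (g i) (v i) x) :
    HasFieldDerivAt (fun y => ∑ i ∈ s, g i y) (∑ i ∈ s, v i) x := by
  intro l
  simpa only [map_sum] using HasDerivAt.fun_sum fun i hi => hg i hi l

lemma _root_.hasFieldDerivAt_zero (x : ℝ) : HasFieldDerivAt (fun _ => (0 : V)) 0 x := by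
  intro l
  simpa using hasDerivAt_const x (0 : ℂ)

/-- One vector must give the derivatives along all linear forms simultaneously; it is assembled from
coordinates in a finite basis. -/
lemma _root_.IsSmoothField.exists_hasFieldDerivAt [FiniteDimensional ℂ V] {g : ℝ → ℝ → V}
    (hg : IsSmoothField g) (t x : ℝ) : ∃ v, HasFieldDerivAt (g t) v x := by
  let b := Module.finBasis ℂ V
  have hd : ∀ l : Module.Dual ℂ V, DifferentiableAt ℝ (fun y => l (g t y)) x := fun l =>
    ((hg l).differentiable (by simp)).comp (f := fun y : ℝ => (t, y)) (by fun_prop) x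
  refine ⟨∑ i, deriv (fun y => b.coord i (g t y)) x • b i, fun l => ?_⟩
  have h : (fun y => l (g t y)) = fun y => ∑ i, b.coord i (g t y) * l (b i) := by
    funext y
    conv_lhs => rw [← b.sum_repr (g t y)]
    simp only [map_sum, map_smul, smul_eq_mul, Module.Basis.coord_apply]
  rw [h, map_sum]
  simp only [map_smul, smul_eq_mul]
  exact HasDerivAt.fun_sum fun i _ => (hd (b.coord i)).hasDerivAt.mul_const _

lemma _root_.HasFieldDerivAt.affineCoeff {A W : ℝ → V} {A' W' : V} {x : ℝ} (a : ℂ) (p : ℕ)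
    (hA : HasFieldDerivAt A A' x) (hW : HasFieldDerivAt W W' x) :
    HasFieldDerivAt (fun y => affineCoeff a (A y) (W y) p) (_root_.affineCoeff a A' W' p) x := by
  unfold _root_.affineCoeff
  split_ifs
  · exact hA.add (hW.const_smul a)
  · exact hW
  · exact hasFieldDerivAt_zero x

lemma _root_.HasFieldDerivAt.simplePolesPlusAffine {n : ℕ} {ζ ε : Fin n → ℂ} {R : Fin n → ℝ → V}
    {R' : Fin n → V} {A W : ℝ → V} {A' W' : V} {x : ℝ}
    (hR : ∀ i, HasFieldDerivAt (R i) (R' i) x)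
    (hA : HasFieldDerivAt A A' x) (hW : HasFieldDerivAt W W' x) (z : ℂ) :
    HasFieldDerivAt (fun y => simplePolesPlusAffine ζ ε (fun i => R i y) (A y) (W y) z)
      (_root_.simplePolesPlusAffine ζ ε R' A' W' z) x :=
  (HasFieldDerivAt.sum fun i _ => ((hR i).const_smul _).const_smul _).add
    (hA.add (hW.const_smul z))

end FieldDerivative

/-! ### The zero curvature equation -/

section ZeroCurvature

variable {D} {n : ℕ} {ζ : Fin n → ℂ} {𝔤 : Type*} [LieRing 𝔤] [LieAlgebra ℂ 𝔤]

lemma _root_.HasFieldDerivAt.taylorGradient {ε : Fin n → ℂ} {R : Fin n → ℝ → 𝔤}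
    {R' : Fin n → 𝔤} {A W : ℝ → 𝔤} {A' W' : 𝔤} {x : ℝ}
    (hR : ∀ i, HasFieldDerivAt (R i) (R' i) x)
    (hA : HasFieldDerivAt A A' x) (hW : HasFieldDerivAt W W' x) (α : S) (p : ℕ) :
    HasFieldDerivAt (fun y => D.taylorGradient ζ ε (fun i => R i y) (A y) (W y) α p)
      (D.taylorGradient ζ ε R' A' W' α p) x :=
  (HasFieldDerivAt.sum fun i _ => ((hR i).const_smul _).const_smul _).add (hA.affineCoeff _ _ hW)

variable {K : ℝ → S → ℕ → 𝔤} {K' : S → ℕ → 𝔤} {x : ℝ}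

lemma hasFieldDerivAt_gaudinLax
    (hK : ∀ α, ∀ p < D.m α, HasFieldDerivAt (fun y => K y α p) (K' α p) x) (z : ℂ) :
    HasFieldDerivAt (fun y => D.gaudinLax (K y) z) (D.gaudinLax K' z) x :=
  HasFieldDerivAt.sum fun α _ => HasFieldDerivAt.sum fun p hp =>
    (hK α p (Finset.mem_range.mp hp)).const_smul _

lemma hasFieldDerivAt_coeffB
    (hK : ∀ α, ∀ p < D.m α, HasFieldDerivAt (fun y => K y α p) (K' α p) x) :
    HasFieldDerivAt (fun y => D.coeffB (K y)) (D.coeffB K') x :=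
  (HasFieldDerivAt.sum fun α _ => HasFieldDerivAt.sum fun p hp =>
    (hK α p (Finset.mem_range.mp hp)).const_smul _).neg

lemma hasFieldDerivAt_coeffB₁
    (hK : ∀ α, ∀ p < D.m α, HasFieldDerivAt (fun y => K y α p) (K' α p) x) :
    HasFieldDerivAt (fun y => D.coeffB₁ (K y)) (D.coeffB₁ K') x :=
  (HasFieldDerivAt.sum fun α _ => HasFieldDerivAt.sum fun p hp =>
    (hK α p (Finset.mem_range.mp hp)).const_smul _).neg

lemma exists_currents_deriv [FiniteDimensional ℂ 𝔤] {J : ℝ → ℝ → S → ℕ → 𝔤}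
    (hJ : ∀ α, ∀ p < D.m α, IsSmoothField fun t x => J t x α p) (t x : ℝ) :
    ∃ K' : S → ℕ → 𝔤, ∀ α, ∀ p < D.m α, HasFieldDerivAt (fun y => J t y α p) (K' α p) x := by
  have h : ∀ α p, ∃ v : 𝔤, p < D.m α → HasFieldDerivAt (fun y => J t y α p) v x := by
    intro α p
    by_cases hp : p < D.m α
    · obtain ⟨v, hv⟩ := (hJ α p hp).exists_hasFieldDerivAt t x
      exact ⟨v, fun _ => hv⟩
    · exact ⟨0, fun h => absurd h hp⟩
  choose K' hK' using h
  exact ⟨K', fun α p hp => hK' α p hp⟩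

/-- The zero curvature equation for a flow generated by the Taylor coefficients at the sites of
the temporal component. -/
lemma HasSimpleZeroes.zeroCurvatureAt (h : D.HasSimpleZeroes ζ) (ε : Fin n → ℂ)
    {J : ℝ → ℝ → S → ℕ → 𝔤} {A V : ℝ → 𝔤} {t x : ℝ} {A' V' : 𝔤} {F : ℝ → S → ℕ → 𝔤}
    {F' : S → ℕ → 𝔤} (hC : D.constraint (J t x) = 0)
    (hK : ∀ α, ∀ p < D.m α, HasFieldDerivAt (fun y => J t y α p) (K' α p) x)
    (hA : HasFieldDerivAt A A' x) (hV : HasFieldDerivAt V V' x)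
    (hF : ∀ y α, ∀ p < D.m α,
      F y α p = D.taylorGradient ζ ε (fun i => D.zeroResidue (J t y) (ζ i)) (A y) (V y) α p)
    (hF' : ∀ α, ∀ p < D.m α, HasFieldDerivAt (fun y => F y α p) (F' α p) x)
    (hflow : ∀ α, ∀ q < D.m α,
      HasFieldDerivAt (fun s => J s x α q) (D.takiffFlow (J t x) (F x) F' α q) t)
    {z : ℂ} (hz : z ∉ Set.range D.pos) (hz' : z ∉ Set.range ζ) {M : ℝ → ℝ → 𝔤}
    (hM : ∀ y, M t y =
      simplePolesPlusAffine ζ ε (fun i => D.zeroResidue (J t y) (ζ i)) (A y) (V y) z) :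
    ZeroCurvatureAt M (fun s y => D.laxL (J s y) z) t x := by
  have hR : ∀ i, HasFieldDerivAt (fun y => D.zeroResidue (J t y) (ζ i))
      (D.zeroResidue K' (ζ i)) x := fun i => (hasFieldDerivAt_gaudinLax hK _).const_smul _
  -- The x-derivative of the gradient is unique, so it consists of the Taylor coefficients of the
  -- x-derivative of 𝓜.
  have hF'' : ∀ α, ∀ p < D.m α,
      F' α p = D.taylorGradient ζ ε (fun i => D.zeroResidue K' (ζ i)) A' V' α p := by
    intro α p hp
    refine (hF' α p hp).unique ?_
    simp only [hF _ α p hp]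
    exact HasFieldDerivAt.taylorGradient hR hA hV α p
  refine ⟨(1 / D.twist z) • D.gaudinLax (D.takiffFlow (J t x) (F x) F') z,
    simplePolesPlusAffine ζ ε (fun i => D.zeroResidue K' (ζ i)) A' V' z,
    (hasFieldDerivAt_gaudinLax hflow z).const_smul _, ?_, ?_⟩
  · simp only [hM]
    exact HasFieldDerivAt.simplePolesPlusAffine hR hA hV z
  · change _ - _ + ⁅M t x, (1 / D.twist z) • D.gaudinLax (J t x) z⁆ = 0
    rw [h.gaudinLax_takiffFlow_eq hC ε (A x) (V x) _ A' V' (hF x) hF'' hz hz', hM, lie_smul,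
      smul_add, smul_smul, one_div_mul_cancel (h.twist_ne_zero hz hz'), one_smul,
      ← lie_skew (D.gaudinLax (J t x) z)]
    module

lemma laxMI_eq (ε : Fin n → ℂ) (J : S → ℕ → 𝔤) (μ : 𝔤) (z : ℂ) :
    D.laxMI ζ ε J μ z =
      simplePolesPlusAffine ζ ε (fun i => D.zeroResidue J (ζ i)) μ 0 z := by
  simp only [laxMI, simplePolesPlusAffine, zeroTerm_eq, smul_zero, add_zero]

/-- The bracket multiplied by ε_M is the affine part of 𝓛: the zero at infinity contributes to 𝓜
through a polynomial instead of a pole. -/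
lemma laxMII_eq (ε : Fin (n + 1) → ℂ) {J : S → ℕ → 𝔤} (μ : 𝔤) {A V : 𝔤} {z : ℂ}
    (hL : D.laxL J z = ∑ i, D.zeroTerm J (ζ i) z + (A + z • V)) :
    D.laxMII ζ ε J μ z =
      simplePolesPlusAffine ζ (fun i => ε i.castSucc) (fun i => D.zeroResidue J (ζ i))
        (ε (Fin.last n) • A + μ) (ε (Fin.last n) • V) z := by
  rw [laxMII, hL, add_sub_cancel_left, simplePolesPlusAffine]
  simp only [zeroTerm_eq]
  module

variable [FiniteDimensional ℂ 𝔤] [LieAlgebra.IsSemisimple ℂ 𝔤] [DecidableEq S]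

lemma HasSimpleZeroes.zeroCurvatureAt_of_chi_ne_zero (h : D.HasSimpleZeroes ζ)
    (hχ : D.chi 0 ≠ 0) (ε : Fin n → ℂ) {J : ℝ → ℝ → S → ℕ → 𝔤} {μ : ℝ → ℝ → 𝔤}
    (hsol : D.IsSolution (D.hamiltonianI ζ ε) J μ) {z : ℂ}
    (hz : z ∉ Set.range D.pos) (hz' : z ∉ Set.range ζ) (t x : ℝ) :
    ZeroCurvatureAt (fun s y => D.laxMI ζ ε (J s y) (μ s y) z)
      (fun s y => D.laxL (J s y) z) t x := by
  obtain ⟨F, F', hgrad, hF', hflow⟩ := hsol.evolution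
  obtain ⟨K', hK'⟩ := exists_currents_deriv hsol.smooth_current t x
  obtain ⟨μ', hμ'⟩ := hsol.smooth_multiplier.exists_hasFieldDerivAt t x
  -- The affine part of 𝓜 is just μ. That of 𝓛, a multiple of B, only serves to evaluate the
  -- residues and does not enter the gradient.
  refine h.zeroCurvatureAt ε (hsol.on_constraint_surface t x) hK' hμ' (hasFieldDerivAt_zero x)
    (fun y α p hp => h.gradient_hamiltonianI ε (A := (1 / D.chi 0) • D.coeffB (J t y)) (V := 0)
      (fun w hw hw' => ?_) (hgrad t y) hp)
    (hF' t x) (hflow t x) hz hz' fun y => laxMI_eq _ _ _ _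
  rw [h.laxL_eq_of_chi_ne_zero hχ (hsol.on_constraint_surface t y) hw hw', smul_zero, add_zero]

lemma HasSimpleZeroes.zeroCurvatureAt_of_chi_eq_zero (h : D.HasSimpleZeroes ζ)
    (hχ : D.chi 0 = 0) (hχ' : deriv D.chi 0 ≠ 0) (ε : Fin (n + 1) → ℂ)
    {J : ℝ → ℝ → S → ℕ → 𝔤} {μ : ℝ → ℝ → 𝔤}
    (hsol : D.IsSolution (D.hamiltonianII ζ ε) J μ) {z : ℂ}
    (hz : z ∉ Set.range D.pos) (hz' : z ∉ Set.range ζ) (t x : ℝ) :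
    ZeroCurvatureAt (fun s y => D.laxMII ζ ε (J s y) (μ s y) z)
      (fun s y => D.laxL (J s y) z) t x := by
  obtain ⟨F, F', hgrad, hF', hflow⟩ := hsol.evolution
  obtain ⟨K', hK'⟩ := exists_currents_deriv hsol.smooth_current t x
  obtain ⟨μ', hμ'⟩ := hsol.smooth_multiplier.exists_hasFieldDerivAt t x
  have hB := hasFieldDerivAt_coeffB hK'
  have hB₁ := hasFieldDerivAt_coeffB₁ hK'
  have hL : ∀ y w, w ∉ Set.range D.pos → w ∉ Set.range ζ → _ := fun y w hw hw' =>
    h.laxL_eq_of_chi_eq_zero hχ hχ' (hsol.on_constraint_surface t y) hw hw'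
  -- Here the affine part of 𝓜 involves B and B₁, which are linear in the currents and hence
  -- differentiable in x.
  exact h.zeroCurvatureAt (fun i => ε i.castSucc) (hsol.on_constraint_surface t x) hK'
    (((((hB₁.const_smul _).sub (hB.const_smul _)).const_smul _).const_smul _).add hμ')
    ((hB.const_smul _).const_smul _)
    (fun y α p hp => h.gradient_hamiltonianII ε (hL y) (hgrad t y) hp)
    (hF' t x) (hflow t x) hz hz' fun y => laxMII_eq ε _ (hL y z hz hz')

end ZeroCurvature

end GaudinDatum

end

theorem mainTheorem8 {𝔤 : Type*} [LieRing 𝔤] [LieAlgebra ℂ 𝔤] [FiniteDimensional ℂ 𝔤]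
    [LieAlgebra.IsSemisimple ℂ 𝔤] {S : Type*} [Fintype S] [DecidableEq S] (D : GaudinDatum S) :
    -- Case (i): the one-form `φ(z) dz` does not vanish at infinity
    (∀ (M : ℕ) (ζ ε : Fin M → ℂ), D.HasSimpleZeroes ζ → D.chi 0 ≠ 0 → (∀ i, ε i ^ 2 = 1) →
      (∀ (J : ℝ → ℝ → S → ℕ → 𝔤) (μ : ℝ → ℝ → 𝔤), D.IsSolution (D.hamiltonianI ζ ε) J μ →
        ∀ z : ℂ, z ∉ Set.range D.pos → z ∉ Set.range ζ → ∀ t x : ℝ,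
          ZeroCurvatureAt (fun s y => D.laxMI ζ ε (J s y) (μ s y) z)
            (fun s y => D.laxL (J s y) z) t x) ∧
      (∀ (J : S → ℕ → 𝔤) (μ : 𝔤), D.constraint J = 0 →
        ∃ B B₁ : 𝔤, D.HasExpansionAtInfinity J B B₁ ∧
          ∀ z : ℂ, z ∉ Set.range D.pos → z ∉ Set.range ζ → ∀ σ : ℂ, σ = 1 ∨ σ = -1 →
            D.laxMI ζ ε J μ z + σ • D.laxL J z =
              (2 * σ) • ∑ i ∈ signSet ε σ,
                  (1 / deriv D.twist (ζ i) * (1 / (z - ζ i))) • D.gaudinLax J (ζ i)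
                + μ + (σ / D.chi 0) • B)) ∧
    -- Case (ii): the one-form `φ(z) dz` has a simple zero at infinity, and `M = n + 1`
    (∀ (n : ℕ) (ζ : Fin n → ℂ) (ε : Fin (n + 1) → ℂ), D.HasSimpleZeroes ζ →
      D.chi 0 = 0 → deriv D.chi 0 ≠ 0 → (∀ i, ε i ^ 2 = 1) →
      (∀ (J : ℝ → ℝ → S → ℕ → 𝔤) (μ : ℝ → ℝ → 𝔤), D.IsSolution (D.hamiltonianII ζ ε) J μ →
        ∀ z : ℂ, z ∉ Set.range D.pos → z ∉ Set.range ζ → ∀ t x : ℝ,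
          ZeroCurvatureAt (fun s y => D.laxMII ζ ε (J s y) (μ s y) z)
            (fun s y => D.laxL (J s y) z) t x) ∧
      (∀ (J : S → ℕ → 𝔤) (μ : 𝔤), D.constraint J = 0 →
        ∃ B B₁ : 𝔤, D.HasExpansionAtInfinity J B B₁ ∧
          ∀ z : ℂ, z ∉ Set.range D.pos → z ∉ Set.range ζ → ∀ σ : ℂ, σ = 1 ∨ σ = -1 →
            D.laxMII ζ ε J μ z + σ • D.laxL J z =
              (2 * σ) •
                  (∑ i ∈ signSet (fun i : Fin n => ε i.castSucc) σ,
                      (1 / deriv D.twist (ζ i) * (1 / (z - ζ i))) • D.gaudinLax J (ζ i)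
                    + (if Fin.last n ∈ signSet ε σ then (1 : ℂ) else 0) •
                        (z / deriv D.chi 0) • B)
                + μ
                + (2 * σ * (if Fin.last n ∈ signSet ε σ then (1 : ℂ) else 0)) •
                    (1 / (2 * deriv D.chi 0 ^ 2)) •
                      ((2 * deriv D.chi 0) • B₁ - iteratedDeriv 2 D.chi 0 • B))) := by
  refine ⟨fun M ζ ε hζ hχ hε => ⟨fun J μ hsol z hz hz' t x =>
      hζ.zeroCurvatureAt_of_chi_ne_zero hχ ε hsol hz hz' t x, fun J μ hC =>
      ⟨D.coeffB J, D.coeffB₁ J, D.hasExpansionAtInfinity J, fun z hz hz' σ hσ =>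
        hζ.lightCone_of_chi_ne_zero hχ hε μ hC hz hz' hσ⟩⟩,
    fun n ζ ε hζ hχ hχ' hε => ⟨fun J μ hsol z hz hz' t x =>
      hζ.zeroCurvatureAt_of_chi_eq_zero hχ hχ' ε hsol hz hz' t x, fun J μ hC =>
      ⟨D.coeffB J, D.coeffB₁ J, D.hasExpansionAtInfinity J, fun z hz hz' σ hσ =>
        hζ.lightCone_of_chi_eq_zero hχ hχ' hε μ hC hz hz' hσ⟩⟩⟩
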